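/- Let $a\in C^\infty(\mathbb R)$, $a\ge 0$, be supported in $(1,2)$ with $\int_1^2 a=1$. Put $\beta(r)=C+\int_1^r\int_1^s a(\tau)\,d\tau\,ds$, where $C$ is the constant for which $\beta(r)=r$ for $r\ge 2$ (so $\beta=C$ for $r\le 1$), and $\langle x\rangle=\beta(|x|)$ for $x\in\mathbb R^3$. Let $$\gamma=\tfrac12\left(\nabla\langle x\rangle\cdot \mathbf p+\mathbf p\cdot\nabla\langle x\rangle\right),\qquad \mathbf p=-i\nabla .$$ Let $\mathcal N(|\phi|,|x|,t)$ be real valued, let $\phi_0\in H^1(\mathbb R^3)$ be radial with $\int|x|^{1/2}|\phi_0|^2dx<\infty$, and let $\phi\in C([0,\infty);H^1(\mathbb R^3))$ be a global radial solution of $$i\partial_t\phi+\Delta\phi=\mathcal N(|\phi|,|x|,t)\,\phi,\qquad \phi(0)=\phi_0,\qquad\text{with}\qquad \sup_{t\ge 0}\|\phi(t)\|_{H^1(\mathbb R^3)}<\infty .$$ Here the equation is understood in $H^{-1}$, integrated in time, with $\mathcal N\phi\in L^1_{loc}([0,\infty);H^{-1})$ acting on $H^1$ by absolutely convergent integrals.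 Let $\alpha\in(\frac13,1)$ and let $F\in C^\infty(\mathbb R)$ be non-decreasing with $F(\lambda)=0$ for $\lambda\le\frac12$ and $F(\lambda)=1$ for $\lambda\ge1$. Write $F=F(\langle x\rangle/t^\alpha)$ for the multiplication operator, and call $$\Gamma=\lim_{t\to+\infty}\bigl(F\gamma F\,\phi(t),\,\phi(t)\bigr)_{L^2(\mathbb R^3)}$$ the $\gamma$-limit of $\phi$ (for this $\alpha$ and $F$) when the limit exists. Then every $\gamma$-limit of $\phi$ is non-negative: $\Gamma\ge 0$. -/

import Mathlib

open MeasureTheory Filter Topology Set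
open scoped ContDiff ComplexConjugate

noncomputable section

namespace RadialNLS

/-- Three-dimensional Euclidean space. -/
abbrev E3 : Type := EuclideanSpace ℝ (Fin 3)

/-- The `j`-th classical partial derivative. -/
def partialDeriv (j : Fin 3) (f : E3 → ℝ) (x : E3) : ℝ :=
  fderiv ℝ f x (EuclideanSpace.single j 1)

/-! ### The Sobolev space `H¹(ℝ³)` through weak derivatives -/

/-- `g` is the weak (distributional) partial derivative `∂ⱼ f` on `ℝ³`. -/
def HasWeakPartial (j : Fin 3) (f g : E3 → ℂ) : Prop :=
  LocallyIntegrable f ∧ LocallyIntegrable g ∧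
    ∀ η : E3 → ℝ, ContDiff ℝ ∞ η → HasCompactSupport η →
      ∫ x, (partialDeriv j η x : ℂ) * f x = -∫ x, (η x : ℂ) * g x

open Classical in
/-- The weak partial derivative `∂ⱼ f`; it is unique almost everywhere if it exists
(and `0` by convention if it does not). -/
def weakPartial (j : Fin 3) (f : E3 → ℂ) : E3 → ℂ :=
  if h : ∃ g, HasWeakPartial j f g then h.choose else 0

/-- `f ∈ H¹(ℝ³)`: `f` and all its first order weak derivatives are in `L²`. -/
def MemH1 (f : E3 → ℂ) : Prop :=
  MemLp f 2 volume ∧ ∀ j : Fin 3, ∃ g : E3 → ℂ, MemLp g 2 volume ∧ HasWeakPartial j f g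

/-- The `H¹` norm `(‖f‖² + ‖∇f‖²)^{1/2}` (of an element of `H¹`). -/
def h1Norm (f : E3 → ℂ) : ℝ :=
  √((∫ x, ‖f x‖ ^ 2) + ∑ j : Fin 3, ∫ x, ‖weakPartial j f x‖ ^ 2)

/-- `f` is (almost everywhere equal to) a function of `|x|`. -/
def IsRadial (f : E3 → ℂ) : Prop :=
  ∃ u : ℝ → ℂ, f =ᵐ[volume] fun x => u ‖x‖

/-! ### The nonlinear Schrödinger equation `i ∂ₜφ + Δφ = 𝒩(|φ|, |x|, t) φ` -/

/-- `∫ ∇f · conj (∇η)`. -/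
def gradPairing (f η : E3 → ℂ) : ℂ :=
  ∫ x, ∑ j : Fin 3, weakPartial j f x * conj (weakPartial j η x)

/-- The interaction term `𝒩(|f|, |x|, t) f`, where `𝒩` is real valued. -/
def interaction (N : ℝ → ℝ → ℝ → ℝ) (t : ℝ) (f : E3 → ℂ) (x : E3) : ℂ :=
  (N ‖f x‖ ‖x‖ t : ℂ) * f x

/-- `φ` is a global (forward in time) spherically symmetric `H¹` solution of
`i ∂ₜφ + Δφ = 𝒩(|φ|, |x|, t) φ` with `φ(0) = φ₀`: `φ ∈ C([0, ∞); H¹)`, the interaction term is in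
`L¹_loc([0, ∞); H⁻¹)`, acting on `H¹` by integration, and the equation holds in `H⁻¹`,
integrated in time. -/
structure IsGlobalSolution (N : ℝ → ℝ → ℝ → ℝ) (φ₀ : E3 → ℂ) (φ : ℝ → E3 → ℂ) : Prop where
  initial : φ 0 =ᵐ[volume] φ₀
  memH1 : ∀ t, 0 ≤ t → MemH1 (φ t)
  radial : ∀ t, 0 ≤ t → IsRadial (φ t)
  continuous : ∀ t, 0 ≤ t →
    Tendsto (fun s => h1Norm (fun x => φ s x - φ t x)) (𝓝[Ici 0] t) (𝓝 0)
  interaction_bound : ∃ K : ℝ → ℝ, LocallyIntegrableOn K (Ici 0) ∧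
    ∀ᵐ t ∂(volume.restrict (Ici (0 : ℝ))), ∀ η, MemH1 η →
      Integrable (fun x => interaction N t (φ t) x * conj (η x)) ∧
      ‖∫ x, interaction N t (φ t) x * conj (η x)‖ ≤ K t * h1Norm η
  equation : ∀ η, MemH1 η → ∀ T, 0 ≤ T →
    IntervalIntegrable (fun t => gradPairing (φ t) η +
      ∫ x, interaction N t (φ t) x * conj (η x)) volume 0 T ∧
    (∫ x, φ T x * conj (η x)) - (∫ x, φ₀ x * conj (η x)) =
      -Complex.I * ∫ t in (0 : ℝ)..T, (gradPairing (φ t) η +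
        ∫ x, interaction N t (φ t) x * conj (η x))

/-- The uniform bound `sup_{t ≥ 0} ‖φ(t)‖_{H¹} < ∞`. -/
def HasUniformH1Bound (φ : ℝ → E3 → ℂ) : Prop :=
  ∃ M : ℝ, ∀ t, 0 ≤ t → h1Norm (φ t) ≤ M

/-! ### The operator `γ` and the `γ`-limit -/

/-- A smooth nonnegative bump `a` supported in `(1, 2)` with integral `1`. -/
structure IsBump (a : ℝ → ℝ) : Prop where
  smooth : ContDiff ℝ ∞ a
  nonneg : ∀ r, 0 ≤ a r
  support : Function.support a ⊆ Ioo 1 2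
  integral : ∫ r in (1 : ℝ)..2, a r = 1

/-- The constant `C` which makes `β` below equal to `r` for `r ≥ 2`. -/
def betaConst (a : ℝ → ℝ) : ℝ := 2 - ∫ s in (1 : ℝ)..2, ∫ τ in (1 : ℝ)..s, a τ

/-- `β(r) = C + ∫₁ʳ ∫₁ˢ a(τ) dτ ds`: smooth and convex, equal to `C` for `r ≤ 1` and
to `r` for `r ≥ 2`. -/
def betaFun (a : ℝ → ℝ) (r : ℝ) : ℝ :=
  betaConst a + ∫ s in (1 : ℝ)..r, ∫ τ in (1 : ℝ)..s, a τ

theorem IsBump.intervalIntegrable {a : ℝ → ℝ} (ha : IsBump a) (b c : ℝ) :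
    IntervalIntegrable a volume b c :=
  ha.smooth.continuous.intervalIntegrable b c

theorem betaFun_of_le_one {a : ℝ → ℝ} (ha : IsBump a) {r : ℝ} (hr : r ≤ 1) :
    betaFun a r = betaConst a := by
  have h0 : ∀ x, x ≤ 1 → a x = 0 := fun x hx => by
    by_contra h
    exact absurd (ha.support h).1 (not_lt.2 hx)
  have h1 : ∫ s in (1 : ℝ)..r, ∫ τ in (1 : ℝ)..s, a τ = ∫ s in (1 : ℝ)..r, (0 : ℝ) := by
    refine intervalIntegral.integral_congr fun s hs => ?_
    rw [uIcc_of_ge hr] at hs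
    have : ∫ τ in (1 : ℝ)..s, a τ = ∫ τ in (1 : ℝ)..s, (0 : ℝ) := by
      refine intervalIntegral.integral_congr fun x hx => ?_
      rw [uIcc_of_ge hs.2] at hx
      exact h0 x hx.2
    simpa using this
  simp [betaFun, h1]

theorem betaFun_of_two_le {a : ℝ → ℝ} (ha : IsBump a) {r : ℝ} (hr : 2 ≤ r) :
    betaFun a r = r := by
  have h0 : ∀ x, 2 ≤ x → a x = 0 := fun x hx => by
    by_contra h
    exact absurd (ha.support h).2 (not_lt.2 hx)
  have hc : Continuous fun s => ∫ τ in (1 : ℝ)..s, a τ :=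
    intervalIntegral.continuous_primitive (fun b c => ha.intervalIntegrable b c) 1
  have h1 : ∫ s in (2 : ℝ)..r, ∫ τ in (1 : ℝ)..s, a τ = ∫ s in (2 : ℝ)..r, (1 : ℝ) := by
    refine intervalIntegral.integral_congr fun s hs => ?_
    rw [uIcc_of_le hr] at hs
    have h2 : ∫ τ in (2 : ℝ)..s, a τ = ∫ τ in (2 : ℝ)..s, (0 : ℝ) := by
      refine intervalIntegral.integral_congr fun x hx => ?_
      rw [uIcc_of_le hs.1] at hx
      exact h0 x hx.1
    have h3 := intervalIntegral.integral_add_adjacent_intervals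
      (ha.intervalIntegrable 1 2) (ha.intervalIntegrable 2 s)
    rw [ha.integral, h2] at h3
    simpa using h3.symm
  have h4 := intervalIntegral.integral_add_adjacent_intervals
    (hc.intervalIntegrable (μ := volume) 1 2) (hc.intervalIntegrable (μ := volume) 2 r)
  rw [betaFun, betaConst, ← h4, h1, intervalIntegral.integral_const, smul_eq_mul]
  ring

/-- The smoothed distance to the origin `⟨x⟩ = β(|x|)`. -/
def japaneseBracket (a : ℝ → ℝ) (x : E3) : ℝ := betaFun a ‖x‖

/-- The momentum operator `pⱼ = -i ∂ⱼ`. -/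
def momentum (j : Fin 3) (ψ : E3 → ℂ) (x : E3) : ℂ := -Complex.I * weakPartial j ψ x

/-- `γ = ½ (∇⟨x⟩ · p + p · ∇⟨x⟩)`. -/
def gammaOp (a : ℝ → ℝ) (ψ : E3 → ℂ) (x : E3) : ℂ :=
  (1 / 2 : ℂ) * ∑ j : Fin 3,
    ((partialDeriv j (japaneseBracket a) x : ℂ) * momentum j ψ x +
      momentum j (fun y => (partialDeriv j (japaneseBracket a) y : ℂ) * ψ y) x)

/-- A smooth characteristic function `F(λ ≥ 1)` of `[1, ∞)`: smooth and increasing, `0` for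
`λ ≤ 1/2` and `1` for `λ ≥ 1`. -/
structure IsSmoothCutoff (F : ℝ → ℝ) : Prop where
  smooth : ContDiff ℝ ∞ F
  mono : Monotone F
  eq_zero : ∀ l, l ≤ 1 / 2 → F l = 0
  eq_one : ∀ l, 1 ≤ l → F l = 1

/-- Multiplication by `F(⟨x⟩ / t^α ≥ 1)`. -/
def exteriorCutoff (a F : ℝ → ℝ) (α t : ℝ) (ψ : E3 → ℂ) (x : E3) : ℂ :=
  (F (japaneseBracket a x / t ^ α) : ℂ) * ψ x

/-- The expectation `⟨F γ F⟩_t = (F γ F φ(t), φ(t))`, with `F = F(⟨x⟩ / t^α ≥ 1)`. -/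
def exteriorGammaExpectation (a F : ℝ → ℝ) (α : ℝ) (φ : ℝ → E3 → ℂ) (t : ℝ) : ℂ :=
  ∫ x, exteriorCutoff a F α t (gammaOp a (exteriorCutoff a F α t (φ t))) x * conj (φ t x)

/-- `Γ` is the `γ`-limit of `φ`: `Γ = lim_{t → ∞} ⟨F γ F⟩_t`. -/
def IsGammaLimit (a F : ℝ → ℝ) (α : ℝ) (φ : ℝ → E3 → ℂ) (Γ : ℝ) : Prop :=
  Tendsto (exteriorGammaExpectation a F α φ) atTop (𝓝 (Γ : ℂ))

end RadialNLS

end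

/-! The real part of (FγFφ, φ) is the flux ∫ F² ∇⟨x⟩ · Im(∇φ conj φ)
(`re_exteriorGammaExpectation`), which is half the growth rate of ∫ w|φ|² for a weight w with ∇w =
F² ∇⟨x⟩. A real interaction contributes nothing to this rate, and the explicit time dependence of w
only lowers it. If Γ were negative, a nonnegative quantity would therefore decrease at a linear rate
forever, which is impossible.

Such a w grows like |x|, so ∫ w|φ|² may diverge. The gradient is therefore cut off at ⟨x⟩ ~ ρ = AT,
where T is the final time (`shellWeight`). The cutoff changes the flux by at most a multiple of the
square root of the mass beyond ρ. That mass is small up to time T once A is large, because mass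
spreads at bounded speed in H¹ (`exists_exterior_mass_le`). The truncated weight is at most ρ
min(⟨x⟩/ρ, 1), so by dominated convergence its mass at the fixed starting time is o(T). A decrease
proportional to T then beats it.

Since φ is merely continuous in H¹ and the interaction merely integrable in time, masses are not
differentiated. Their increments over short intervals are compared instead (`weightedMass_sub_le`,
for a fixed weight), and `le_of_locally_antitone` chains the local bounds. The same device handles
the moving weight in `weightedMass_shellWeight_le`. -/

noncomputable section

namespace RadialNLS

/-! ### Weak derivatives -/

theorem partialDeriv_mul {j : Fin 3} {f g : E3 → ℝ} (hf : Differentiable ℝ f)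
    (hg : Differentiable ℝ g) (x : E3) :
    partialDeriv j (fun y => f y * g y) x = f x * partialDeriv j g x + g x * partialDeriv j f x := by
  unfold partialDeriv
  rw [fderiv_fun_mul (hf x) (hg x)]
  simp

theorem continuous_partialDeriv {j : Fin 3} {f : E3 → ℝ} (hf : ContDiff ℝ ∞ f) :
    Continuous (partialDeriv j f) :=
  (hf.continuous_fderiv (by simp)).clm_apply continuous_const

theorem contDiff_partialDeriv {j : Fin 3} {f : E3 → ℝ} (hf : ContDiff ℝ ∞ f) :
    ContDiff ℝ ∞ (partialDeriv j f) :=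
  (hf.fderiv_right (m := ∞) (by simp)).clm_apply contDiff_const

theorem hasCompactSupport_partialDeriv {j : Fin 3} {f : E3 → ℝ} (hf : HasCompactSupport f) :
    HasCompactSupport (partialDeriv j f) :=
  hf.fderiv_apply (𝕜 := ℝ) _

theorem integrable_ofReal_mul {f : E3 → ℂ} (hf : LocallyIntegrable f) {η : E3 → ℝ}
    (hη : Continuous η) (hc : HasCompactSupport η) : Integrable (fun x => (η x : ℂ) * f x) := by
  simpa using hf.integrable_smul_left_of_hasCompactSupport hη hc

theorem HasWeakPartial.ae_eq {j : Fin 3} {f g g' : E3 → ℂ} (h : HasWeakPartial j f g)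
    (h' : HasWeakPartial j f g') : g =ᵐ[volume] g' := by
  refine ae_eq_of_integral_contDiff_smul_eq h.2.1 h'.2.1 fun η hη hc => ?_
  have := (h.2.2 η hη hc).symm.trans (h'.2.2 η hη hc)
  simpa using this

theorem HasWeakPartial.weakPartial_ae_eq {j : Fin 3} {f g : E3 → ℂ} (h : HasWeakPartial j f g) :
    weakPartial j f =ᵐ[volume] g := by
  have hex : ∃ g, HasWeakPartial j f g := ⟨g, h⟩
  rw [weakPartial, dif_pos hex]
  exact hex.choose_spec.ae_eq h

theorem HasWeakPartial.add {j : Fin 3} {f g f' g' : E3 → ℂ} (h : HasWeakPartial j f g)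
    (h' : HasWeakPartial j f' g') :
    HasWeakPartial j (fun x => f x + f' x) (fun x => g x + g' x) := by
  refine ⟨h.1.add h'.1, h.2.1.add h'.2.1, fun η hη hc => ?_⟩
  have hd := continuous_partialDeriv (j := j) hη
  have hdc := hasCompactSupport_partialDeriv (j := j) hc
  simp only [mul_add]
  rw [integral_add (integrable_ofReal_mul h.1 hd hdc) (integrable_ofReal_mul h'.1 hd hdc),
    integral_add (integrable_ofReal_mul h.2.1 hη.continuous hc)
      (integrable_ofReal_mul h'.2.1 hη.continuous hc), h.2.2 η hη hc, h'.2.2 η hη hc]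
  ring

theorem HasWeakPartial.const_mul {j : Fin 3} {f g : E3 → ℂ} (h : HasWeakPartial j f g) (c : ℂ) :
    HasWeakPartial j (fun x => c * f x) (fun x => c * g x) := by
  refine ⟨h.1.smul c, h.2.1.smul c, fun η hη hc => ?_⟩
  have := h.2.2 η hη hc
  simp only [mul_left_comm _ c]
  rw [integral_const_mul, integral_const_mul, this]
  ring

/-- The product `η * w` is again a test function; testing `h` against it and expanding its
derivative gives the product rule. -/
theorem HasWeakPartial.smooth_mul {j : Fin 3} {f g : E3 → ℂ} (h : HasWeakPartial j f g)
    {w : E3 → ℝ} (hw : ContDiff ℝ ∞ w) :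
    HasWeakPartial j (fun x => (w x : ℂ) * f x)
      (fun x => (partialDeriv j w x : ℂ) * f x + (w x : ℂ) * g x) := by
  have hd := continuous_partialDeriv (j := j) hw
  have hl : ∀ {v : E3 → ℝ} {k : E3 → ℂ}, Continuous v → LocallyIntegrable k →
      LocallyIntegrable (fun x => (v x : ℂ) * k x) := fun hv hk => by
    simpa using hk.continuous_smul hv
  refine ⟨hl hw.continuous h.1, (hl hd h.1).add (hl hw.continuous h.2.1), fun η hη hc => ?_⟩
  have h1 := h.2.2 (fun x => η x * w x) (hη.mul hw) hc.mul_right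
  have hdη := continuous_partialDeriv (j := j) hη
  have i1 := integrable_ofReal_mul (hl hw.continuous h.1) hdη
    (hasCompactSupport_partialDeriv (j := j) hc)
  have i2 := integrable_ofReal_mul (hl hd h.1) hη.continuous hc
  have i3 := integrable_ofReal_mul (hl hw.continuous h.2.1) hη.continuous hc
  simp only [mul_add]
  rw [integral_add i2 i3]
  have e1 : ∫ x, (partialDeriv j (fun x => η x * w x) x : ℂ) * f x =
      (∫ x, (η x : ℂ) * ((partialDeriv j w x : ℂ) * f x)) +
        ∫ x, (partialDeriv j η x : ℂ) * ((w x : ℂ) * f x) := by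
    rw [← integral_add i2 i1]
    refine integral_congr_ae (ae_of_all _ fun x => ?_)
    simp only [partialDeriv_mul (hη.differentiable (by simp)) (hw.differentiable (by simp)) x]
    push_cast
    ring
  have e2 : ∫ x, ((η x * w x : ℝ) : ℂ) * g x = ∫ x, (η x : ℂ) * ((w x : ℂ) * g x) := by
    refine integral_congr_ae (ae_of_all _ fun x => ?_)
    push_cast
    ring
  rw [e1, e2] at h1
  linear_combination h1

/-! ### The space `H¹` -/

theorem MemH1.hasWeakPartial {f : E3 → ℂ} (h : MemH1 f) (j : Fin 3) :
    HasWeakPartial j f (weakPartial j f) := by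
  obtain ⟨g, -, hg⟩ := h.2 j
  have hex : ∃ g, HasWeakPartial j f g := ⟨g, hg⟩
  rw [weakPartial, dif_pos hex]
  exact hex.choose_spec

theorem MemH1.memLp_weakPartial {f : E3 → ℂ} (h : MemH1 f) (j : Fin 3) :
    MemLp (weakPartial j f) 2 volume := by
  obtain ⟨g, hg2, hg⟩ := h.2 j
  exact hg2.ae_eq hg.weakPartial_ae_eq.symm

theorem memLp_two_ofReal_mul {f : E3 → ℂ} (hf : MemLp f 2 volume) {w : E3 → ℝ}
    (hw : Continuous w) {C : ℝ} (hC : ∀ x, |w x| ≤ C) :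
    MemLp (fun x => (w x : ℂ) * f x) 2 volume := by
  refine hf.of_le_mul (c := C) ?_ (ae_of_all _ fun x => ?_)
  · exact (Complex.continuous_ofReal.comp hw).aestronglyMeasurable.mul hf.aestronglyMeasurable
  · rw [norm_mul, Complex.norm_real, Real.norm_eq_abs]
    exact mul_le_mul_of_nonneg_right (hC x) (norm_nonneg _)

theorem MemH1.add {f g : E3 → ℂ} (hf : MemH1 f) (hg : MemH1 g) : MemH1 (fun x => f x + g x) :=
  ⟨hf.1.add hg.1, fun j => ⟨_, (hf.memLp_weakPartial j).add (hg.memLp_weakPartial j),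
    (hf.hasWeakPartial j).add (hg.hasWeakPartial j)⟩⟩

theorem MemH1.const_mul {f : E3 → ℂ} (hf : MemH1 f) (c : ℂ) : MemH1 (fun x => c * f x) :=
  ⟨hf.1.const_mul c, fun j => ⟨_, (hf.memLp_weakPartial j).const_mul c,
    (hf.hasWeakPartial j).const_mul c⟩⟩

theorem MemH1.sub {f g : E3 → ℂ} (hf : MemH1 f) (hg : MemH1 g) : MemH1 (fun x => f x - g x) := by
  simpa [sub_eq_add_neg] using hf.add (hg.const_mul (-1))

/-- A smooth weight, bounded by `W` and with partial derivatives bounded by `L`. -/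
structure IsWeight (w : E3 → ℝ) (W L : ℝ) : Prop where
  smooth : ContDiff ℝ ∞ w
  bound : ∀ x, |w x| ≤ W
  bound_deriv : ∀ j x, |partialDeriv j w x| ≤ L

theorem MemH1.weight_mul {f : E3 → ℂ} (hf : MemH1 f) {w : E3 → ℝ} {W L : ℝ}
    (hw : IsWeight w W L) : MemH1 (fun x => (w x : ℂ) * f x) :=
  ⟨memLp_two_ofReal_mul hf.1 hw.smooth.continuous hw.bound, fun j =>
    ⟨_, (memLp_two_ofReal_mul hf.1 (continuous_partialDeriv hw.smooth) (hw.bound_deriv j)).add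
      (memLp_two_ofReal_mul (hf.memLp_weakPartial j) hw.smooth.continuous hw.bound),
      (hf.hasWeakPartial j).smooth_mul hw.smooth⟩⟩

/-! ### Inequalities for the L² and H¹ norms. -/

theorem integrable_norm_sq {f : E3 → ℂ} (hf : MemLp f 2 volume) :
    Integrable (fun x => ‖f x‖ ^ 2) :=
  (memLp_two_iff_integrable_sq_norm hf.1).1 hf

theorem integrable_norm_mul_norm {f g : E3 → ℂ} (hf : MemLp f 2 volume) (hg : MemLp g 2 volume) :
    Integrable (fun x => ‖f x‖ * ‖g x‖) :=
  MemLp.integrable_mul hf.norm hg.norm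

theorem integral_norm_mul_norm_le {f g : E3 → ℂ} (hf : MemLp f 2 volume)
    (hg : MemLp g 2 volume) :
    ∫ x, ‖f x‖ * ‖g x‖ ≤ √(∫ x, ‖f x‖ ^ 2) * √(∫ x, ‖g x‖ ^ 2) := by
  have := integral_mul_norm_le_Lp_mul_Lq (μ := volume) (f := f) (g := g)
    (p := 2) (q := 2) (Real.HolderConjugate.two_two) (by simpa using hf) (by simpa using hg)
  simpa [Real.sqrt_eq_rpow] using this

theorem h1Norm_sq (f : E3 → ℂ) :
    h1Norm f ^ 2 = (∫ x, ‖f x‖ ^ 2) + ∑ j : Fin 3, ∫ x, ‖weakPartial j f x‖ ^ 2 :=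
  Real.sq_sqrt (add_nonneg (integral_nonneg fun _ => sq_nonneg _)
    (Finset.sum_nonneg fun _ _ => integral_nonneg fun _ => sq_nonneg _))

theorem h1Norm_nonneg (f : E3 → ℂ) : 0 ≤ h1Norm f := Real.sqrt_nonneg _

theorem sqrt_integral_norm_sq_le_h1Norm (f : E3 → ℂ) : √(∫ x, ‖f x‖ ^ 2) ≤ h1Norm f :=
  Real.sqrt_le_sqrt (le_add_of_nonneg_right
    (Finset.sum_nonneg fun _ _ => integral_nonneg fun _ => sq_nonneg _))

theorem sqrt_integral_weakPartial_sq_le_h1Norm (f : E3 → ℂ) (j : Fin 3) :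
    √(∫ x, ‖weakPartial j f x‖ ^ 2) ≤ h1Norm f := by
  refine Real.sqrt_le_sqrt (le_trans ?_ (le_add_of_nonneg_left
    (integral_nonneg fun _ => sq_nonneg _)))
  exact Finset.single_le_sum (f := fun j => ∫ x, ‖weakPartial j f x‖ ^ 2)
    (fun _ _ => integral_nonneg fun _ => sq_nonneg _) (Finset.mem_univ j)

theorem integral_norm_sq_add_le {f g : E3 → ℂ} (hf : MemLp f 2 volume) (hg : MemLp g 2 volume) :
    ∫ x, ‖f x + g x‖ ^ 2 ≤ 2 * (∫ x, ‖f x‖ ^ 2) + 2 * ∫ x, ‖g x‖ ^ 2 := by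
  rw [← integral_const_mul, ← integral_const_mul,
    ← integral_add ((integrable_norm_sq hf).const_mul 2) ((integrable_norm_sq hg).const_mul 2)]
  refine integral_mono (integrable_norm_sq (hf.add hg))
    (((integrable_norm_sq hf).const_mul 2).add ((integrable_norm_sq hg).const_mul 2)) fun x => ?_
  have h := norm_add_le (f x) (g x)
  have := norm_nonneg (f x + g x)
  dsimp only
  nlinarith [sq_nonneg (‖f x‖ - ‖g x‖)]

theorem integral_norm_sq_ofReal_mul_le {f : E3 → ℂ} (hf : MemLp f 2 volume) {w : E3 → ℝ} {C : ℝ}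
    (hC : ∀ x, |w x| ≤ C) :
    ∫ x, ‖(w x : ℂ) * f x‖ ^ 2 ≤ C ^ 2 * ∫ x, ‖f x‖ ^ 2 := by
  rw [← integral_const_mul]
  refine integral_mono_of_nonneg (ae_of_all _ fun _ => sq_nonneg _)
    ((integrable_norm_sq hf).const_mul _) (ae_of_all _ fun x => ?_)
  dsimp only
  rw [norm_mul, mul_pow, Complex.norm_real, Real.norm_eq_abs]
  exact mul_le_mul_of_nonneg_right (pow_le_pow_left₀ (abs_nonneg _) (hC x) 2) (sq_nonneg _)

theorem integral_norm_sq_congr {f g : E3 → ℂ} (h : f =ᵐ[volume] g) :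
    ∫ x, ‖f x‖ ^ 2 = ∫ x, ‖g x‖ ^ 2 :=
  integral_congr_ae (by filter_upwards [h] with x hx; rw [hx])

/-- The factor 2 comes from using |a+b|² ≤ 2|a|² + 2|b|² in place of Minkowski; only smallness
matters later. -/
theorem h1Norm_add_le {f g : E3 → ℂ} (hf : MemH1 f) (hg : MemH1 g) :
    h1Norm (fun x => f x + g x) ≤ 2 * (h1Norm f + h1Norm g) := by
  have key : h1Norm (fun x => f x + g x) ^ 2 ≤ 2 * h1Norm f ^ 2 + 2 * h1Norm g ^ 2 := by
    simp only [h1Norm_sq, mul_add, Finset.mul_sum]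
    have h0 := integral_norm_sq_add_le hf.1 hg.1
    have h1 : ∑ j : Fin 3, ∫ x, ‖weakPartial j (fun x => f x + g x) x‖ ^ 2 ≤
        ∑ j : Fin 3, 2 * (∫ x, ‖weakPartial j f x‖ ^ 2) +
          ∑ j : Fin 3, 2 * ∫ x, ‖weakPartial j g x‖ ^ 2 := by
      rw [← Finset.sum_add_distrib]
      refine Finset.sum_le_sum fun j _ => ?_
      rw [integral_norm_sq_congr
        ((hf.hasWeakPartial j).add (hg.hasWeakPartial j)).weakPartial_ae_eq]
      exact integral_norm_sq_add_le (hf.memLp_weakPartial j) (hg.memLp_weakPartial j)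
    linarith
  have h1 := h1Norm_nonneg f
  have h2 := h1Norm_nonneg g
  refine abs_le_of_sq_le_sq' ?_ (by positivity) |>.2
  nlinarith [mul_nonneg h1 h2]

theorem h1Norm_const_mul {f : E3 → ℂ} (hf : MemH1 f) (c : ℂ) :
    h1Norm (fun x => c * f x) = ‖c‖ * h1Norm f := by
  have h : h1Norm (fun x => c * f x) ^ 2 = (‖c‖ * h1Norm f) ^ 2 := by
    rw [mul_pow]
    simp only [h1Norm_sq, mul_add, Finset.mul_sum]
    congr 1
    · simp only [norm_mul, mul_pow, integral_const_mul]
    · refine Finset.sum_congr rfl fun j _ => ?_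
      rw [integral_norm_sq_congr ((hf.hasWeakPartial j).const_mul c).weakPartial_ae_eq]
      simp only [norm_mul, mul_pow, integral_const_mul]
  exact (sq_eq_sq₀ (h1Norm_nonneg _) (mul_nonneg (norm_nonneg _) (h1Norm_nonneg _))).1 h

theorem h1Norm_weight_mul_le {f : E3 → ℂ} (hf : MemH1 f) {w : E3 → ℝ} {W L : ℝ}
    (hw : IsWeight w W L) :
    h1Norm (fun x => (w x : ℂ) * f x) ≤ 3 * (W + L) * h1Norm f := by
  have hW : 0 ≤ W := (abs_nonneg _).trans (hw.bound 0)
  have hL : 0 ≤ L := (abs_nonneg _).trans (hw.bound_deriv 0 0)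
  have h0 := integral_norm_sq_ofReal_mul_le hf.1 hw.bound
  have h1 : ∀ j : Fin 3, ∫ x, ‖weakPartial j (fun x => (w x : ℂ) * f x) x‖ ^ 2 ≤
      2 * (L ^ 2 * ∫ x, ‖f x‖ ^ 2) + 2 * (W ^ 2 * ∫ x, ‖weakPartial j f x‖ ^ 2) := fun j => by
    rw [integral_norm_sq_congr ((hf.hasWeakPartial j).smooth_mul hw.smooth).weakPartial_ae_eq]
    refine (integral_norm_sq_add_le
      (memLp_two_ofReal_mul hf.1 (continuous_partialDeriv hw.smooth) (hw.bound_deriv j))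
      (memLp_two_ofReal_mul (hf.memLp_weakPartial j) hw.smooth.continuous hw.bound)).trans ?_
    gcongr
    · exact integral_norm_sq_ofReal_mul_le hf.1 (hw.bound_deriv j)
    · exact integral_norm_sq_ofReal_mul_le (hf.memLp_weakPartial j) hw.bound
  have hA : 0 ≤ ∫ x, ‖f x‖ ^ 2 := integral_nonneg fun _ => sq_nonneg _
  have hB : ∀ j : Fin 3, 0 ≤ ∫ x, ‖weakPartial j f x‖ ^ 2 :=
    fun j => integral_nonneg fun _ => sq_nonneg _
  refine abs_le_of_sq_le_sq' ?_
    (mul_nonneg (by positivity) (h1Norm_nonneg _)) |>.2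
  rw [mul_pow, h1Norm_sq, h1Norm_sq]
  simp only [Fin.sum_univ_three]
  have c0 := h1 0
  have c1 := h1 1
  have c2 := h1 2
  have b0 := hB 0
  have b1 := hB 1
  have b2 := hB 2
  have hWL : 0 ≤ W * L := mul_nonneg hW hL
  nlinarith [mul_nonneg (sq_nonneg W) hA, mul_nonneg (sq_nonneg L) hA, mul_nonneg hWL hA,
    mul_nonneg (sq_nonneg W) b0, mul_nonneg (sq_nonneg L) b0, mul_nonneg hWL b0,
    mul_nonneg (sq_nonneg W) b1, mul_nonneg (sq_nonneg L) b1, mul_nonneg hWL b1,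
    mul_nonneg (sq_nonneg W) b2, mul_nonneg (sq_nonneg L) b2, mul_nonneg hWL b2]

/-! ### Weighted masses and their fluxes -/

/-- The weighted mass `∫ w |f|²`. -/
def weightedMass (w : E3 → ℝ) (f : E3 → ℂ) : ℝ := ∫ x, w x * ‖f x‖ ^ 2

/-- The density `Im (∂ⱼf · conj f)` of the mass current. -/
def massCurrent (j : Fin 3) (f : E3 → ℂ) (x : E3) : ℝ := (weakPartial j f x * conj (f x)).im

/-- The flux `∫ ∇w · Im (∇f conj f)` through the weight `w`. -/
def massFlux (w : E3 → ℝ) (f : E3 → ℂ) : ℝ :=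
  ∫ x, ∑ j : Fin 3, partialDeriv j w x * massCurrent j f x

theorem integrable_mul_conj {f g : E3 → ℂ} (hf : MemLp f 2 volume) (hg : MemLp g 2 volume) :
    Integrable (fun x => f x * conj (g x)) :=
  MemLp.integrable_mul hf hg.star

theorem MemH1.integrable_gradPairing {f η : E3 → ℂ} (hf : MemH1 f) (hη : MemH1 η) :
    Integrable (fun x => ∑ j : Fin 3, weakPartial j f x * conj (weakPartial j η x)) :=
  integrable_finsetSum _ fun j _ =>
    integrable_mul_conj (hf.memLp_weakPartial j) (hη.memLp_weakPartial j)

theorem gradPairing_add {f η ζ : E3 → ℂ} (hf : MemH1 f) (hη : MemH1 η) (hζ : MemH1 ζ) :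
    gradPairing f (fun x => η x + ζ x) = gradPairing f η + gradPairing f ζ := by
  unfold gradPairing
  rw [← integral_add (hf.integrable_gradPairing hη) (hf.integrable_gradPairing hζ)]
  refine integral_congr_ae ?_
  have h := ae_all_iff.2 fun j : Fin 3 =>
    ((hη.hasWeakPartial j).add (hζ.hasWeakPartial j)).weakPartial_ae_eq
  filter_upwards [h] with x hx
  rw [← Finset.sum_add_distrib]
  refine Finset.sum_congr rfl fun j _ => ?_
  rw [hx j, map_add, mul_add]

theorem norm_gradPairing_le {f η : E3 → ℂ} (hf : MemH1 f) (hη : MemH1 η) :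
    ‖gradPairing f η‖ ≤ 3 * h1Norm f * h1Norm η := by
  unfold gradPairing
  rw [integral_finsetSum _ fun j _ =>
    integrable_mul_conj (hf.memLp_weakPartial j) (hη.memLp_weakPartial j)]
  have h : ∀ j : Fin 3, ‖∫ x, weakPartial j f x * conj (weakPartial j η x)‖ ≤
      h1Norm f * h1Norm η := fun j => by
    refine (norm_integral_le_integral_norm _).trans ?_
    simp only [norm_mul, RCLike.norm_conj]
    refine (integral_norm_mul_norm_le (hf.memLp_weakPartial j) (hη.memLp_weakPartial j)).trans ?_
    exact mul_le_mul (sqrt_integral_weakPartial_sq_le_h1Norm f j)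
      (sqrt_integral_weakPartial_sq_le_h1Norm η j) (Real.sqrt_nonneg _) (h1Norm_nonneg _)
  refine (norm_sum_le _ _).trans ((Finset.sum_le_sum fun j _ => h j).trans ?_)
  simp only [Finset.sum_const, Finset.card_univ, Fintype.card_fin, nsmul_eq_mul]
  apply le_of_eq
  push_cast
  ring

theorem im_gradPairing_weight_mul {f : E3 → ℂ} (hf : MemH1 f) {w : E3 → ℝ} {W L : ℝ}
    (hw : IsWeight w W L) : (gradPairing f (fun x => (w x : ℂ) * f x)).im = massFlux w f := by
  have hint := hf.integrable_gradPairing (hf.weight_mul hw)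
  have : (gradPairing f (fun x => (w x : ℂ) * f x)).im =
      ∫ x, (∑ j : Fin 3, weakPartial j f x *
        conj (weakPartial j (fun x => (w x : ℂ) * f x) x)).im := (integral_im hint).symm
  rw [this]
  refine integral_congr_ae ?_
  have h := ae_all_iff.2 fun j : Fin 3 =>
    ((hf.hasWeakPartial j).smooth_mul hw.smooth).weakPartial_ae_eq
  filter_upwards [h] with x hx
  rw [Complex.im_sum]
  refine Finset.sum_congr rfl fun j _ => ?_
  rw [hx j]
  simp [massCurrent]
  ring

theorem integrable_weight_mul_norm_sq {f : E3 → ℂ} (hf : MemLp f 2 volume) {w : E3 → ℝ} {W L : ℝ}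
    (hw : IsWeight w W L) : Integrable (fun x => w x * ‖f x‖ ^ 2) :=
  (integrable_norm_sq hf).bdd_mul hw.smooth.continuous.aestronglyMeasurable
    (ae_of_all _ fun x => by simpa using hw.bound x)

/-- Pointwise, |g|² − |f|² = Re((g − f) conj(f + g)). The increment of a mass thus becomes an
increment against one test function, to which the integrated equation applies. -/
theorem weightedMass_sub_eq {f g : E3 → ℂ} (hf : MemH1 f) (hg : MemH1 g) {w : E3 → ℝ} {W L : ℝ}
    (hw : IsWeight w W L) :
    weightedMass w g - weightedMass w f =
      ((∫ x, g x * conj ((w x : ℂ) * (f x + g x))) -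
        ∫ x, f x * conj ((w x : ℂ) * (f x + g x))).re := by
  have h := ((hf.add hg).weight_mul hw).1
  have i1 := integrable_mul_conj hg.1 h
  have i2 := integrable_mul_conj hf.1 h
  rw [← integral_sub i1 i2]
  have : (∫ x, (g x * conj ((w x : ℂ) * (f x + g x)) - f x * conj ((w x : ℂ) * (f x + g x)))).re =
      ∫ x, (g x * conj ((w x : ℂ) * (f x + g x)) - f x * conj ((w x : ℂ) * (f x + g x))).re :=
    (integral_re (i1.sub i2)).symm
  rw [this, weightedMass, weightedMass, ← integral_sub (integrable_weight_mul_norm_sq hg.1 hw)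
    (integrable_weight_mul_norm_sq hf.1 hw)]
  refine integral_congr_ae (ae_of_all _ fun x => ?_)
  dsimp only
  rw [Complex.sq_norm, Complex.sq_norm, Complex.normSq_apply, Complex.normSq_apply]
  simp
  ring

/-- A function on an interval which is locally antitone takes a smaller value at the right end. -/
theorem le_of_locally_antitone {G : ℝ → ℝ} {a b : ℝ} (hab : a ≤ b)
    (h : ∀ u ∈ Icc a b, ∃ δ > 0, ∀ s ∈ Icc a b, ∀ t ∈ Icc a b, |s - u| < δ → |t - u| < δ →
      s ≤ t → G t ≤ G s) : G b ≤ G a := by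
  choose! δ hδ hG using h
  -- By compactness, a monotone sequence goes from `a` to `b` in finitely many steps, each step
  -- lying in a single ball of the cover.
  obtain ⟨t, h0, hmono, ⟨m, hm⟩, hc⟩ := exists_monotone_Icc_subset_open_cover_Icc hab
    (c := fun u : Icc a b => Metric.ball u (δ u)) (fun _ => Metric.isOpen_ball)
    (fun u _ => mem_iUnion.2 ⟨u, Metric.mem_ball_self (hδ u u.2)⟩)
  have key : ∀ n, G (t n) ≤ G a := fun n => by
    induction n with
    | zero => simp [h0]
    | succ n ih =>
      obtain ⟨u, hu⟩ := hc n
      have h1 := hu (left_mem_Icc.2 (hmono (Nat.le_succ n)))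
      have h2 := hu (right_mem_Icc.2 (hmono (Nat.le_succ n)))
      exact (hG u u.2 (t n) (t n).2 (t (n + 1)) (t (n + 1)).2 h1 h2
        (hmono (Nat.le_succ n))).trans ih
  have := key m
  rwa [hm m le_rfl] at this

/-! ### Growth of weighted masses along a solution. -/

section Solution

variable {N : ℝ → ℝ → ℝ → ℝ} {φ₀ : E3 → ℂ} {φ : ℝ → E3 → ℂ}

theorem IsGlobalSolution.weightedMass_sub_eq_im (hφ : IsGlobalSolution N φ₀ φ) {w : E3 → ℝ}
    {W L : ℝ} (hw : IsWeight w W L) {s t : ℝ} (hs : 0 ≤ s) (ht : 0 ≤ t) :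
    IntervalIntegrable (fun v => gradPairing (φ v) (fun x => (w x : ℂ) * (φ s x + φ t x)) +
      ∫ x, interaction N v (φ v) x * conj ((w x : ℂ) * (φ s x + φ t x))) volume s t ∧
    weightedMass w (φ t) - weightedMass w (φ s) =
      ∫ v in s..t, (gradPairing (φ v) (fun x => (w x : ℂ) * (φ s x + φ t x)) +
        ∫ x, interaction N v (φ v) x * conj ((w x : ℂ) * (φ s x + φ t x))).im := by
  have hη := ((hφ.memH1 s hs).add (hφ.memH1 t ht)).weight_mul hw
  obtain ⟨i1, e1⟩ := hφ.equation _ hη s hs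
  obtain ⟨i2, e2⟩ := hφ.equation _ hη t ht
  have i3 := i1.symm.trans i2
  refine ⟨i3, ?_⟩
  rw [weightedMass_sub_eq (hφ.memH1 s hs) (hφ.memH1 t ht) hw]
  have e3 := intervalIntegral.integral_interval_sub_left i2 i1
  have e4 := Complex.imCLM.intervalIntegral_comp_comm i3
  simp only [Complex.imCLM_apply] at e4
  rw [e4, ← e3]
  have e5 := sub_sub_sub_cancel_right (∫ x, φ t x * conj ((w x : ℂ) * (φ s x + φ t x)))
    (∫ x, φ s x * conj ((w x : ℂ) * (φ s x + φ t x)))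
    (∫ x, φ₀ x * conj ((w x : ℂ) * (φ s x + φ t x)))
  rw [← e5, e1, e2, ← mul_sub]
  simp

/-- Here `f` plays the role of φ(s) + φ(t), close to 2φ(v) for nearby times. The part 2φ(v) yields
exactly twice the flux, and the remainder is estimated in H¹. -/
theorem IsGlobalSolution.im_pairing_le (hφ : IsGlobalSolution N φ₀ φ) {w : E3 → ℝ}
    {W L : ℝ} (hw : IsWeight w W L) {v k : ℝ} (hv : 0 ≤ v)
    (hk : ∀ η, MemH1 η →
      Integrable (fun x => interaction N v (φ v) x * conj (η x)) ∧
      ‖∫ x, interaction N v (φ v) x * conj (η x)‖ ≤ k * h1Norm η)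
    {f : E3 → ℂ} (hf : MemH1 f) :
    (gradPairing (φ v) (fun x => (w x : ℂ) * f x) +
      ∫ x, interaction N v (φ v) x * conj ((w x : ℂ) * f x)).im ≤
      2 * massFlux w (φ v) + (3 * h1Norm (φ v) + |k|) *
        (3 * (W + L) * h1Norm (fun x => f x - 2 * φ v x)) := by
  have hv1 := hφ.memH1 v hv
  have hwv := hv1.weight_mul hw
  have hρ : MemH1 (fun x => f x - 2 * φ v x) := hf.sub (hv1.const_mul 2)
  have hwρ := hρ.weight_mul hw
  have hsplit : (fun x => (w x : ℂ) * f x) = fun x =>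
      ((w x : ℂ) * φ v x + (w x : ℂ) * φ v x) + (w x : ℂ) * (f x - 2 * φ v x) := by
    funext x
    ring
  -- Reality of `N` and `w` makes the integrand N w |φ|² real.
  have hreal : (∫ x, interaction N v (φ v) x * conj ((w x : ℂ) * φ v x)).im = 0 := by
    have : ∀ x, interaction N v (φ v) x * conj ((w x : ℂ) * φ v x) =
        ((N ‖φ v x‖ ‖x‖ v * w x * ‖φ v x‖ ^ 2 : ℝ) : ℂ) := fun x => by
      have := Complex.mul_conj' (φ v x)
      simp only [interaction, map_mul, Complex.conj_ofReal]
      push_cast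
      rw [← this]
      ring
    simp only [this]
    exact (congrArg Complex.im integral_ofReal).trans (Complex.ofReal_im _)
  have h1 : gradPairing (φ v) (fun x => (w x : ℂ) * f x) =
      gradPairing (φ v) (fun x => (w x : ℂ) * φ v x) +
      gradPairing (φ v) (fun x => (w x : ℂ) * φ v x) +
      gradPairing (φ v) (fun x => (w x : ℂ) * (f x - 2 * φ v x)) := by
    rw [hsplit, gradPairing_add hv1 (hwv.add hwv) hwρ, gradPairing_add hv1 hwv hwv]
  have h2 : (∫ x, interaction N v (φ v) x * conj ((w x : ℂ) * f x)) =
      (∫ x, interaction N v (φ v) x * conj ((w x : ℂ) * φ v x)) +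
      (∫ x, interaction N v (φ v) x * conj ((w x : ℂ) * φ v x)) +
      ∫ x, interaction N v (φ v) x * conj ((w x : ℂ) * (f x - 2 * φ v x)) := by
    have i1 := (hk _ hwv).1
    have i2 := (hk _ hwρ).1
    rw [← integral_add i1 i1]
    refine Eq.trans ?_ (integral_add (i1.add i1) i2)
    refine integral_congr_ae (ae_of_all _ fun x => ?_)
    dsimp only [Pi.add_apply]
    rw [congrFun hsplit x]
    simp only [map_add]
    ring
  rw [h1, h2]
  simp only [Complex.add_im, hreal, im_gradPairing_weight_mul hv1 hw]
  have b1 := (Complex.im_le_norm _).trans (norm_gradPairing_le hv1 hwρ)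
  have b2 := (Complex.im_le_norm _).trans (hk _ hwρ).2
  have b3 := h1Norm_weight_mul_le hρ hw
  have b4 := mul_le_mul_of_nonneg_right (le_abs_self k)
    (h1Norm_nonneg (fun x => (w x : ℂ) * (f x - 2 * φ v x)))
  have b5 := mul_le_mul_of_nonneg_left b3
    (add_nonneg (mul_nonneg zero_le_three (h1Norm_nonneg (φ v))) (abs_nonneg k))
  linarith

theorem IsGlobalSolution.h1Norm_add_sub_le (hφ : IsGlobalSolution N φ₀ φ) {u s t v ε : ℝ}
    (hu : 0 ≤ u) (hs : 0 ≤ s) (ht : 0 ≤ t) (hv : 0 ≤ v)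
    (hsu : h1Norm (fun x => φ s x - φ u x) ≤ ε) (htu : h1Norm (fun x => φ t x - φ u x) ≤ ε)
    (hvu : h1Norm (fun x => φ v x - φ u x) ≤ ε) :
    h1Norm (fun x => (φ s x + φ t x) - 2 * φ v x) ≤ 12 * ε := by
  have hs1 := (hφ.memH1 s hs).sub (hφ.memH1 u hu)
  have ht1 := (hφ.memH1 t ht).sub (hφ.memH1 u hu)
  have hv1 := (hφ.memH1 v hv).sub (hφ.memH1 u hu)
  have e : (fun x => (φ s x + φ t x) - 2 * φ v x) = fun x =>
      ((φ s x - φ u x) + (φ t x - φ u x)) + (-2) * (φ v x - φ u x) := by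
    funext x
    ring
  have b1 := h1Norm_add_le (hs1.add ht1) (hv1.const_mul (-2))
  have b2 := h1Norm_add_le hs1 ht1
  rw [h1Norm_const_mul hv1, norm_neg, Complex.norm_ofNat] at b1
  rw [e]
  linarith

/-- **Propagation estimate for a fixed weight**: a bound on the flux bounds the growth of the
weighted mass. The interaction, being real, does not contribute. -/
theorem IsGlobalSolution.weightedMass_sub_le (hφ : IsGlobalSolution N φ₀ φ) {M : ℝ}
    (hM : ∀ t, 0 ≤ t → h1Norm (φ t) ≤ M) {w : E3 → ℝ} {W L : ℝ} (hw : IsWeight w W L)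
    {a b c : ℝ} (ha : 0 ≤ a) (hab : a ≤ b)
    (hc : ∀ v ∈ Icc a b, 2 * massFlux w (φ v) ≤ c) :
    weightedMass w (φ b) - weightedMass w (φ a) ≤ c * (b - a) := by
  obtain ⟨K, hK, hKφ⟩ := hφ.interaction_bound
  have hM0 : 0 ≤ M := (h1Norm_nonneg _).trans (hM 0 le_rfl)
  have hW : 0 ≤ W := (abs_nonneg _).trans (hw.bound 0)
  have hL : 0 ≤ L := (abs_nonneg _).trans (hw.bound_deriv 0 0)
  set k : ℝ → ℝ := fun v => 3 * M + |K v| with hkdef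
  have hkint : ∀ s ∈ Icc a b, ∀ t ∈ Icc a b, s ≤ t → IntervalIntegrable k volume s t := by
    intro s hs t ht hst
    have : IntegrableOn K (Icc s t) := hK.integrableOn_compact_subset
      (fun x hx => ha.trans (hs.1.trans hx.1)) isCompact_Icc
    have hKi : IntervalIntegrable K volume s t :=
      (intervalIntegrable_iff_integrableOn_Icc_of_le hst).2 this
    exact intervalIntegrable_const.add hKi.abs
  have hmain : ∀ ε > 0, weightedMass w (φ b) - weightedMass w (φ a) ≤
      c * (b - a) + ε * ∫ v in a..b, k v := by
    intro ε hε
    -- The term ε∫k absorbs the error of replacing φ(s) + φ(t) by 2φ(v); it is additive over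
    -- intervals, so it survives the chaining.
    have := le_of_locally_antitone (G := fun t => weightedMass w (φ t) - c * t -
      ε * ∫ v in a..t, k v) hab ?_
    · simp only [intervalIntegral.integral_same, mul_zero, sub_zero] at this
      linarith
    intro u hu
    have hu0 := ha.trans hu.1
    -- 36 = 3 · 12, from `h1Norm_weight_mul_le` and `h1Norm_add_sub_le`; the added 1 keeps the
    -- denominator positive.
    have hε0 : 0 < ε / (36 * (W + L + 1)) := by positivity
    set ε₀ := ε / (36 * (W + L + 1)) with hε₀
    have hcont := (tendsto_order.1 (hφ.continuous u hu0)).2 ε₀ hε0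
    obtain ⟨δ, hδ, hball⟩ := Metric.mem_nhdsWithin_iff.1 hcont
    have hclose : ∀ s ∈ Icc a b, |s - u| < δ → h1Norm (fun x => φ s x - φ u x) ≤ ε₀ :=
      fun s hs hsu => le_of_lt (hball ⟨hsu, ha.trans hs.1⟩)
    refine ⟨δ, hδ, fun s hs t ht hsu htu hst => ?_⟩
    have hs0 := ha.trans hs.1
    have ht0 := ha.trans ht.1
    obtain ⟨i1, e1⟩ := hφ.weightedMass_sub_eq_im hw hs0 ht0
    have hkst := hkint s hs t ht hst
    have hle : (∫ v in s..t, (gradPairing (φ v) (fun x => (w x : ℂ) * (φ s x + φ t x)) +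
        ∫ x, interaction N v (φ v) x * conj ((w x : ℂ) * (φ s x + φ t x))).im) ≤
        ∫ v in s..t, (c + ε * k v) := by
      refine intervalIntegral.integral_mono_ae_restrict hst ?_
        (intervalIntegrable_const.add (hkst.const_mul ε)) ?_
      · exact ⟨i1.1.im, i1.2.im⟩
      · have hsub : Icc s t ⊆ Ici (0 : ℝ) := fun v hv => hs0.trans hv.1
        filter_upwards [ae_restrict_of_ae_restrict_of_subset hsub hKφ,
          ae_restrict_mem measurableSet_Icc] with v hv hvst
        have hv0 := hs0.trans hvst.1
        have hvab : v ∈ Icc a b := ⟨hs.1.trans hvst.1, hvst.2.trans ht.2⟩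
        have hvu : |v - u| < δ := by
          rw [abs_lt] at *
          constructor <;> linarith [hvst.1, hvst.2]
        refine (hφ.im_pairing_le hw hv0 hv ((hφ.memH1 s hs0).add (hφ.memH1 t ht0))).trans ?_
        have b1 := hφ.h1Norm_add_sub_le hu0 hs0 ht0 hv0 (hclose s hs hsu) (hclose t ht htu)
          (hclose v hvab hvu)
        refine add_le_add (hc v hvab) ?_
        have b2 : 3 * (W + L) * h1Norm (fun x => (φ s x + φ t x) - 2 * φ v x) ≤ ε := by
          calc _ ≤ 3 * (W + L) * (12 * ε₀) := by gcongr
            _ ≤ 36 * (W + L + 1) * ε₀ := by nlinarith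
            _ = ε := by rw [hε₀]; field_simp
        rw [mul_comm ε]
        have b3 := hM v hv0
        have b4 := h1Norm_nonneg (φ v)
        refine mul_le_mul ?_ b2 (mul_nonneg (by positivity) (h1Norm_nonneg _)) ?_
        · simp only [hkdef]
          linarith
        · simp only [hkdef]
          positivity
    rw [intervalIntegral.integral_add intervalIntegrable_const (hkst.const_mul ε),
      intervalIntegral.integral_const, intervalIntegral.integral_const_mul, smul_eq_mul] at hle
    have hadj := intervalIntegral.integral_add_adjacent_intervals
      (hkint a (left_mem_Icc.2 hab) s hs hs.1) hkst
    rw [← hadj]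
    linarith
  have hI : 0 ≤ ∫ v in a..b, k v :=
    intervalIntegral.integral_nonneg hab fun v _ => by simp only [hkdef]; positivity
  refine le_of_forall_pos_le_add fun ε hε => ?_
  refine (hmain (ε / ((∫ v in a..b, k v) + 1)) (by positivity)).trans ?_
  have : ε / ((∫ v in a..b, k v) + 1) * (∫ v in a..b, k v) ≤ ε := by
    rw [div_mul_eq_mul_div, div_le_iff₀ (by positivity)]
    nlinarith
  linarith

end Solution

/-! ### The smoothed distance to the origin -/

theorem contDiff_integral_of_contDiff {f : ℝ → ℝ} (hf : ContDiff ℝ ∞ f) (c : ℝ) :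
    ContDiff ℝ ∞ (fun r => ∫ s in c..r, f s) := by
  have hd : ∀ r, HasDerivAt (fun r => ∫ s in c..r, f s) (f r) r := fun r =>
    hf.continuous.integral_hasStrictDerivAt c r |>.hasDerivAt
  refine contDiff_infty_iff_deriv.2 ⟨fun r => (hd r).differentiableAt, ?_⟩
  rwa [funext fun r => (hd r).deriv]

section Bump

variable {a : ℝ → ℝ}

/-- The derivative `∫₁ʳ a` of `β`. -/
def betaDeriv (a : ℝ → ℝ) (r : ℝ) : ℝ := ∫ τ in (1 : ℝ)..r, a τ

theorem IsBump.contDiff_betaDeriv (ha : IsBump a) : ContDiff ℝ ∞ (betaDeriv a) :=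
  contDiff_integral_of_contDiff ha.smooth 1

theorem IsBump.hasDerivAt_betaDeriv (ha : IsBump a) (r : ℝ) : HasDerivAt (betaDeriv a) (a r) r :=
  ha.smooth.continuous.integral_hasStrictDerivAt 1 r |>.hasDerivAt

theorem IsBump.contDiff_betaFun (ha : IsBump a) : ContDiff ℝ ∞ (betaFun a) :=
  contDiff_const.add (contDiff_integral_of_contDiff ha.contDiff_betaDeriv 1)

theorem IsBump.hasDerivAt_betaFun (ha : IsBump a) (r : ℝ) :
    HasDerivAt (betaFun a) (betaDeriv a r) r :=
  (ha.contDiff_betaDeriv.continuous.integral_hasStrictDerivAt 1 r).hasDerivAt.const_add _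

theorem IsBump.betaDeriv_of_le_one (ha : IsBump a) {r : ℝ} (hr : r ≤ 1) : betaDeriv a r = 0 := by
  have h : EqOn (betaFun a) (fun _ => betaConst a) (Iic 1) := fun s hs => betaFun_of_le_one ha hs
  have hc : IsClosed {r | betaDeriv a r = 0} :=
    isClosed_eq ha.contDiff_betaDeriv.continuous continuous_const
  have hlt : Iio (1 : ℝ) ⊆ {r | betaDeriv a r = 0} := fun s hs => by
    have he : betaFun a =ᶠ[𝓝 s] fun _ => betaConst a :=
      mem_of_superset (Iio_mem_nhds (mem_Iio.1 hs)) fun y hy => h (le_of_lt (mem_Iio.1 hy))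
    exact (ha.hasDerivAt_betaFun s).unique ((hasDerivAt_const s _).congr_of_eventuallyEq he)
  have := hc.closure_subset_iff.2 hlt
  rw [closure_Iio] at this
  exact this hr

theorem IsBump.monotone_betaDeriv (ha : IsBump a) : Monotone (betaDeriv a) :=
  monotone_of_hasDerivAt_nonneg ha.hasDerivAt_betaDeriv ha.nonneg

theorem IsBump.betaDeriv_nonneg (ha : IsBump a) (r : ℝ) : 0 ≤ betaDeriv a r := by
  rcases le_total r 1 with h | h
  · exact (ha.betaDeriv_of_le_one h).ge
  · exact (ha.betaDeriv_of_le_one le_rfl).ge.trans (ha.monotone_betaDeriv h)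

theorem IsBump.betaDeriv_le_one (ha : IsBump a) (r : ℝ) : betaDeriv a r ≤ 1 := by
  have h2 : betaDeriv a (max r 2 + 1) = 1 := by
    have he : betaFun a =ᶠ[𝓝 (max r 2 + 1)] fun y => y :=
      mem_of_superset (Ioi_mem_nhds (show (2 : ℝ) < max r 2 + 1 by linarith [le_max_right r 2]))
        fun y hy => betaFun_of_two_le ha (le_of_lt hy)
    exact (ha.hasDerivAt_betaFun _).unique ((hasDerivAt_id _).congr_of_eventuallyEq he)
  rw [← h2]
  exact ha.monotone_betaDeriv (by linarith [le_max_left r 2])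

theorem IsBump.monotone_betaFun (ha : IsBump a) : Monotone (betaFun a) :=
  monotone_of_hasDerivAt_nonneg ha.hasDerivAt_betaFun ha.betaDeriv_nonneg

/-- Slope at most 1 together with β(2) = 2 forces the minimum C = β(1) to be at least 1. -/
theorem IsBump.japaneseBracket_nonneg (ha : IsBump a) (x : E3) : 0 ≤ japaneseBracket a x := by
  have h1 : betaFun a 2 - betaFun a 1 ≤ 1 * (2 - 1) :=
    image_sub_le_mul_sub_of_deriv_le (fun r => (ha.hasDerivAt_betaFun r).differentiableAt)
      (fun r => (ha.hasDerivAt_betaFun r).deriv ▸ ha.betaDeriv_le_one r) (by norm_num)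
  rw [betaFun_of_two_le ha le_rfl, betaFun_of_le_one ha le_rfl] at h1
  rw [japaneseBracket]
  rcases le_total ‖x‖ 1 with h | h
  · rw [betaFun_of_le_one ha h]
    linarith
  · have := ha.monotone_betaFun h
    rw [betaFun_of_le_one ha le_rfl] at this
    linarith

theorem IsBump.japaneseBracket_eq_const (ha : IsBump a) {x : E3} (hx : ‖x‖ < 1) :
    japaneseBracket a =ᶠ[𝓝 x] fun _ => betaConst a :=
  mem_of_superset ((isOpen_lt continuous_norm continuous_const).mem_nhds hx)
    fun _ hy => betaFun_of_le_one ha (le_of_lt hy)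

theorem IsBump.contDiff_japaneseBracket (ha : IsBump a) : ContDiff ℝ ∞ (japaneseBracket a) := by
  refine contDiff_iff_contDiffAt.2 fun x => ?_
  by_cases hx : ‖x‖ < 1
  · exact contDiffAt_const.congr_of_eventuallyEq (ha.japaneseBracket_eq_const hx)
  · have hx0 : x ≠ 0 := fun h => hx (by simp [h])
    exact ha.contDiff_betaFun.contDiffAt.comp x (contDiffAt_norm ℝ hx0)

/-! ### First and second derivatives of the bracket. -/

theorem hasDerivAt_norm_add_smul (j : Fin 3) {x : E3} (hx : x ≠ 0) :
    HasDerivAt (fun t : ℝ => ‖x + t • EuclideanSpace.single j (1 : ℝ)‖) (x j / ‖x‖) 0 := by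
  have h1 : HasDerivAt (fun t : ℝ => x + t • EuclideanSpace.single j (1 : ℝ))
      (EuclideanSpace.single j (1 : ℝ)) 0 := by
    simpa using ((hasDerivAt_id (0 : ℝ)).smul_const
      (EuclideanSpace.single j (1 : ℝ) : E3)).const_add x
  have h2 := h1.norm_sq.sqrt (by simpa using hx)
  simp only [zero_smul, add_zero, Real.sqrt_sq (norm_nonneg _)] at h2
  convert h2 using 1
  rw [EuclideanSpace.inner_single_right]
  simp
  field_simp

theorem partialDeriv_eq_of_hasDerivAt {j : Fin 3} {f : E3 → ℝ} {x : E3} {d : ℝ}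
    (hf : DifferentiableAt ℝ f x)
    (h : HasDerivAt (fun t : ℝ => f (x + t • EuclideanSpace.single j (1 : ℝ))) d 0) :
    partialDeriv j f x = d := by
  have h1 : HasDerivAt (fun t : ℝ => x + t • EuclideanSpace.single j (1 : ℝ))
      (EuclideanSpace.single j (1 : ℝ)) 0 := by
    simpa using ((hasDerivAt_id (0 : ℝ)).smul_const
      (EuclideanSpace.single j (1 : ℝ) : E3)).const_add x
  have h2 : HasFDerivAt f (fderiv ℝ f x) (x + (0 : ℝ) • EuclideanSpace.single j (1 : ℝ)) := by
    simpa using hf.hasFDerivAt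
  exact (h2.comp_hasDerivAt 0 h1).unique h

/-- At the origin the quotient is 0 by convention, harmlessly: β' vanishes on the unit ball. -/
theorem IsBump.partialDeriv_japaneseBracket (ha : IsBump a) (j : Fin 3) (x : E3) :
    partialDeriv j (japaneseBracket a) x = betaDeriv a ‖x‖ * (x j / ‖x‖) := by
  by_cases hx : ‖x‖ < 1
  · rw [ha.betaDeriv_of_le_one hx.le, zero_mul, partialDeriv,
      (ha.japaneseBracket_eq_const hx).fderiv_eq]
    simp
  · have hx0 : x ≠ 0 := fun h => hx (by simp [h])
    refine partialDeriv_eq_of_hasDerivAt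
      (ha.contDiff_japaneseBracket.differentiable (by simp) x) ?_
    have h := ha.hasDerivAt_betaFun ‖x + (0 : ℝ) • EuclideanSpace.single j (1 : ℝ)‖
    have := h.comp (0 : ℝ) (hasDerivAt_norm_add_smul j hx0)
    rw [zero_smul, add_zero] at this
    exact this

theorem abs_apply_div_norm_le_one (j : Fin 3) (x : E3) : |x j / ‖x‖| ≤ 1 := by
  rw [abs_div, abs_norm]
  exact div_le_one_of_le₀ (by simpa using PiLp.norm_apply_le x j) (norm_nonneg _)

theorem IsBump.abs_partialDeriv_japaneseBracket_le (ha : IsBump a) (j : Fin 3) (x : E3) :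
    |partialDeriv j (japaneseBracket a) x| ≤ 1 := by
  rw [ha.partialDeriv_japaneseBracket, abs_mul, abs_of_nonneg (ha.betaDeriv_nonneg _)]
  exact mul_le_one₀ (ha.betaDeriv_le_one _) (abs_nonneg _) (abs_apply_div_norm_le_one j x)

theorem IsBump.exists_le (ha : IsBump a) : ∃ B, ∀ r, |a r| ≤ B := by
  have hc : HasCompactSupport a :=
    HasCompactSupport.of_support_subset_isCompact isCompact_Icc
      (ha.support.trans Ioo_subset_Icc_self)
  simpa using hc.exists_bound_of_continuous ha.smooth.continuous

/-- With y = xⱼ/|x| the derivative is a(|x|) y² + β'(|x|)(1 − y²)/|x|, and β' vanishes for |x| < 1.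
The bound puts the term ½ Δ⟨x⟩ ψ of γψ in L². -/
theorem IsBump.exists_abs_partialDeriv_partialDeriv_le (ha : IsBump a) :
    ∃ B, ∀ j x, |partialDeriv j (partialDeriv j (japaneseBracket a)) x| ≤ B := by
  obtain ⟨B, hB⟩ := ha.exists_le
  have hB0 : 0 ≤ B := (abs_nonneg _).trans (hB 0)
  refine ⟨B + 2, fun j x => ?_⟩
  have hfun : partialDeriv j (japaneseBracket a) =
      fun x => betaDeriv a ‖x‖ * (x j / ‖x‖) := funext (ha.partialDeriv_japaneseBracket j)
  by_cases hx : ‖x‖ < 1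
  · have : partialDeriv j (japaneseBracket a) =ᶠ[𝓝 x] fun _ => 0 :=
      mem_of_superset ((isOpen_lt continuous_norm continuous_const).mem_nhds hx) fun y hy => by
        rw [mem_ofPred_eq]
        rw [ha.partialDeriv_japaneseBracket, ha.betaDeriv_of_le_one (le_of_lt hy), zero_mul]
    rw [partialDeriv, this.fderiv_eq]
    simp
    linarith
  · have hx1 := not_lt.1 hx
    have hx0 : x ≠ 0 := fun h => hx (by simp [h])
    have hn : HasDerivAt (fun t : ℝ => ‖x + t • EuclideanSpace.single j (1 : ℝ)‖)
      (x j / ‖x‖) 0 := hasDerivAt_norm_add_smul j hx0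
    have hβ := (ha.hasDerivAt_betaDeriv ‖x + (0 : ℝ) • EuclideanSpace.single j (1 : ℝ)‖).comp
      (0 : ℝ) hn
    have hxj : HasDerivAt (fun t : ℝ => (x + t • EuclideanSpace.single j (1 : ℝ)) j) 1 0 := by
      simpa using (hasDerivAt_id (0 : ℝ)).const_add (x j)
    have hd := hβ.mul (hxj.div hn (by simpa using hx0))
    have hd2 : partialDeriv j (partialDeriv j (japaneseBracket a)) x = _ :=
      partialDeriv_eq_of_hasDerivAt
        ((contDiff_partialDeriv ha.contDiff_japaneseBracket).differentiable (by simp) x)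
        (by rw [hfun]; exact hd)
    rw [hd2]
    simp only [Function.comp_apply, Pi.div_apply, zero_smul, add_zero, one_mul]
    have hy := abs_apply_div_norm_le_one j x
    have e : (‖x‖ - x j * (x j / ‖x‖)) / ‖x‖ ^ 2 = (1 - (x j / ‖x‖) ^ 2) / ‖x‖ := by
      field_simp
    rw [e]
    set y := x j / ‖x‖
    have hy2 : y ^ 2 ≤ 1 := (sq_le_one_iff_abs_le_one y).2 hy
    have b1 : |a ‖x‖ * y * y| ≤ B := by
      rw [mul_assoc, ← sq, abs_mul, abs_of_nonneg (sq_nonneg y)]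
      exact (mul_le_of_le_one_right (abs_nonneg _) hy2).trans (hB _)
    have b2 : |betaDeriv a ‖x‖ * ((1 - y ^ 2) / ‖x‖)| ≤ 1 := by
      rw [abs_of_nonneg (mul_nonneg (ha.betaDeriv_nonneg _)
        (div_nonneg (by linarith) (norm_nonneg _)))]
      refine mul_le_one₀ (ha.betaDeriv_le_one _) (div_nonneg (by linarith) (norm_nonneg _)) ?_
      exact div_le_one_of_le₀ (by nlinarith [sq_nonneg y]) (norm_nonneg _)
    exact (abs_add_le _ _).trans (by linarith)

theorem IsBump.partialDeriv_comp_japaneseBracket (ha : IsBump a) {G : ℝ → ℝ}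
    (hG : ContDiff ℝ ∞ G) (j : Fin 3) (x : E3) :
    partialDeriv j (fun y => G (japaneseBracket a y)) x =
      deriv G (japaneseBracket a x) * partialDeriv j (japaneseBracket a) x := by
  have h1 := (hG.differentiable (by simp) (japaneseBracket a x)).hasDerivAt
  have h2 := (ha.contDiff_japaneseBracket.differentiable (by simp) x).hasFDerivAt
  have := (h1.comp_hasFDerivAt x h2).fderiv
  unfold partialDeriv
  change fderiv ℝ (G ∘ japaneseBracket a) x _ = _
  rw [this]
  simp

theorem IsBump.isWeight_comp_japaneseBracket (ha : IsBump a) {G : ℝ → ℝ} (hG : ContDiff ℝ ∞ G)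
    {W L : ℝ} (hW : ∀ r, 0 ≤ r → |G r| ≤ W) (hL : ∀ r, 0 ≤ r → |deriv G r| ≤ L) :
    IsWeight (fun x => G (japaneseBracket a x)) W L where
  smooth := hG.comp ha.contDiff_japaneseBracket
  bound x := hW _ (ha.japaneseBracket_nonneg x)
  bound_deriv j x := by
    rw [ha.partialDeriv_comp_japaneseBracket hG, abs_mul]
    have h := hL _ (ha.japaneseBracket_nonneg x)
    have h1 := mul_le_mul h (ha.abs_partialDeriv_japaneseBracket_le j x) (abs_nonneg _)
      ((abs_nonneg _).trans h)
    rwa [mul_one] at h1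

end Bump

/-! ### The cutoff -/

section Cutoff

variable {F : ℝ → ℝ}

theorem IsSmoothCutoff.nonneg (hF : IsSmoothCutoff F) (l : ℝ) : 0 ≤ F l := by
  rcases le_total l (1 / 2) with h | h
  · exact (hF.eq_zero l h).ge
  · exact (hF.eq_zero (1 / 2) le_rfl).ge.trans (hF.mono h)

theorem IsSmoothCutoff.le_one (hF : IsSmoothCutoff F) (l : ℝ) : F l ≤ 1 := by
  rcases le_total l 1 with h | h
  · exact (hF.mono h).trans (hF.eq_one 1 le_rfl).le
  · exact (hF.eq_one l h).le

theorem IsSmoothCutoff.abs_le_one (hF : IsSmoothCutoff F) (l : ℝ) : |F l| ≤ 1 := by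
  rw [abs_of_nonneg (hF.nonneg l)]
  exact hF.le_one l

theorem IsSmoothCutoff.exists_abs_deriv_le (hF : IsSmoothCutoff F) : ∃ L, ∀ l, |deriv F l| ≤ L := by
  have hc : HasCompactSupport (deriv F) := by
    refine HasCompactSupport.intro (isCompact_Icc (a := (1 / 2 : ℝ)) (b := 1)) fun l hl => ?_
    rw [mem_Icc, not_and_or, not_le, not_le] at hl
    rcases hl with h | h
    · have : F =ᶠ[𝓝 l] fun _ => 0 :=
        mem_of_superset (Iio_mem_nhds h) fun y hy => hF.eq_zero y (le_of_lt hy)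
      rw [this.deriv_eq, deriv_const]
    · have : F =ᶠ[𝓝 l] fun _ => 1 :=
        mem_of_superset (Ioi_mem_nhds h) fun y hy => hF.eq_one y (le_of_lt hy)
      rw [this.deriv_eq, deriv_const]
  simpa using hc.exists_bound_of_continuous (hF.smooth.continuous_deriv (by simp))

theorem IsSmoothCutoff.contDiff_div (hF : IsSmoothCutoff F) (R : ℝ) :
    ContDiff ℝ ∞ (fun r => F (r / R)) := hF.smooth.comp (contDiff_id.div_const R)

theorem deriv_comp_div (F : ℝ → ℝ) (R r : ℝ) :
    deriv (fun r => F (r / R)) r = deriv F (r / R) / R := by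
  have := deriv_comp_mul_left R⁻¹ F r
  simpa only [inv_mul_eq_div, smul_eq_mul] using this

/-- The gradient bound L/R, with L independent of R, is what limits the speed at which mass crosses
radius R. -/
theorem IsSmoothCutoff.exists_isWeight (hF : IsSmoothCutoff F) {a : ℝ → ℝ} (ha : IsBump a) :
    ∃ L, 0 ≤ L ∧ ∀ R, 0 < R → IsWeight (fun x => F (japaneseBracket a x / R)) 1 (L / R) := by
  obtain ⟨L, hL⟩ := hF.exists_abs_deriv_le
  refine ⟨L, (abs_nonneg _).trans (hL 0), fun R hR =>
    ha.isWeight_comp_japaneseBracket (G := fun r => F (r / R)) (hF.contDiff_div R)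
      (fun r _ => hF.abs_le_one _) fun r _ => ?_⟩
  rw [deriv_comp_div, abs_div, abs_of_pos hR]
  exact div_le_div_of_nonneg_right (hL _) hR.le

end Cutoff

/-! ### The expectation of `γ` in the exterior region -/

theorem gammaOp_ae_eq {a : ℝ → ℝ} (ha : IsBump a) {ψ : E3 → ℂ} (hψ : MemH1 ψ) :
    gammaOp a ψ =ᵐ[volume] fun x => -Complex.I * ∑ j : Fin 3,
      ((partialDeriv j (japaneseBracket a) x : ℂ) * weakPartial j ψ x +
        (1 / 2 : ℂ) * ((partialDeriv j (partialDeriv j (japaneseBracket a)) x : ℂ) * ψ x)) := by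
  have h := ae_all_iff.2 fun j : Fin 3 => ((hψ.hasWeakPartial j).smooth_mul
    (contDiff_partialDeriv (j := j) ha.contDiff_japaneseBracket)).weakPartial_ae_eq
  filter_upwards [h] with x hx
  rw [gammaOp, Finset.mul_sum, Finset.mul_sum]
  refine Finset.sum_congr rfl fun j _ => ?_
  rw [momentum, momentum, hx j]
  ring

/-- Derivatives falling on F or on ∇⟨x⟩ leave −i times a real multiple of |φ|², which has no real
part; only the current term remains. -/
theorem re_exteriorGammaExpectation {a F : ℝ → ℝ} (ha : IsBump a) (hF : IsSmoothCutoff F) {α t : ℝ}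
    (ht : 0 < t) {φ : ℝ → E3 → ℂ} (hφ : MemH1 (φ t)) :
    (exteriorGammaExpectation a F α φ t).re = ∫ x, ∑ j : Fin 3,
      F (japaneseBracket a x / t ^ α) ^ 2 * partialDeriv j (japaneseBracket a) x *
        massCurrent j (φ t) x := by
  obtain ⟨L, -, hL⟩ := hF.exists_isWeight ha
  have hw := hL (t ^ α) (Real.rpow_pos_of_pos ht α)
  obtain ⟨B, hB⟩ := ha.exists_abs_partialDeriv_partialDeriv_le
  set G : E3 → ℝ := fun x => F (japaneseBracket a x / t ^ α) with hG
  have hψ : MemH1 (fun x => (G x : ℂ) * φ t x) := hφ.weight_mul hw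
  have hcut : exteriorCutoff a F α t (φ t) = fun x => (G x : ℂ) * φ t x := rfl
  have hb := ha.contDiff_japaneseBracket
  have hγ := gammaOp_ae_eq ha hψ
  have hγ2 : MemLp (gammaOp a (fun x => (G x : ℂ) * φ t x)) 2 volume := by
    have h : ∀ j ∈ (Finset.univ : Finset (Fin 3)), MemLp (fun x =>
        (partialDeriv j (japaneseBracket a) x : ℂ) * weakPartial j (fun x => (G x : ℂ) * φ t x) x +
        (1 / 2 : ℂ) * ((partialDeriv j (partialDeriv j (japaneseBracket a)) x : ℂ) *
          ((G x : ℂ) * φ t x))) 2 volume := fun j _ =>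
      (memLp_two_ofReal_mul (hψ.memLp_weakPartial j) (continuous_partialDeriv hb)
        (ha.abs_partialDeriv_japaneseBracket_le j)).add
        ((memLp_two_ofReal_mul hψ.1 (continuous_partialDeriv (contDiff_partialDeriv hb))
          (hB j)).const_mul _)
    have h' := (memLp_finsetSum _ h).const_mul (-Complex.I)
    exact h'.ae_eq hγ.symm
  have hGγ : MemLp (fun x => (G x : ℂ) * gammaOp a (fun x => (G x : ℂ) * φ t x) x) 2 volume :=
    memLp_two_ofReal_mul hγ2 hw.smooth.continuous hw.bound
  have hint := integrable_mul_conj hGγ hφ.1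
  have hre : (exteriorGammaExpectation a F α φ t).re =
      ∫ x, ((G x : ℂ) * gammaOp a (fun x => (G x : ℂ) * φ t x) x * conj (φ t x)).re :=
    (integral_re hint).symm
  rw [hre]
  refine integral_congr_ae ?_
  have hd := ae_all_iff.2 fun j : Fin 3 =>
    ((hφ.hasWeakPartial j).smooth_mul hw.smooth).weakPartial_ae_eq
  filter_upwards [hγ, hd] with x hx hdx
  rw [hx, Finset.mul_sum, Finset.mul_sum, Finset.sum_mul, Complex.re_sum]
  refine Finset.sum_congr rfl fun j _ => ?_
  rw [hdx j]
  simp [massCurrent]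
  ring

/-! ### Bounds on fluxes -/

theorem abs_massCurrent_le (j : Fin 3) (f : E3 → ℂ) (x : E3) :
    |massCurrent j f x| ≤ ‖weakPartial j f x‖ * ‖f x‖ := by
  refine (Complex.abs_im_le_norm _).trans ?_
  rw [norm_mul, RCLike.norm_conj]

theorem MemH1.integrable_massCurrent {f : E3 → ℂ} (hf : MemH1 f) (j : Fin 3) :
    Integrable (massCurrent j f) :=
  (integrable_mul_conj (hf.memLp_weakPartial j) hf.1).im

theorem MemH1.integrable_mul_massCurrent {f : E3 → ℂ} (hf : MemH1 f) (j : Fin 3) {g : E3 → ℝ}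
    (hg : Continuous g) {C : ℝ} (hC : ∀ x, |g x| ≤ C) :
    Integrable (fun x => g x * massCurrent j f x) :=
  (hf.integrable_massCurrent j).bdd_mul hg.aestronglyMeasurable
    (ae_of_all _ fun x => by simpa using hC x)

/-- If `|g| ≤ ε + χ` with a cutoff `χ`, the current tested against `g` is controlled by `ε` and
by the mass in the region of the cutoff. -/
theorem integral_mul_massCurrent_le {f : E3 → ℂ} (hf : MemH1 f) (j : Fin 3) {g χ : E3 → ℝ}
    {ε W L M : ℝ} (hχ : IsWeight χ W L) (h0 : ∀ x, 0 ≤ χ x) (h1 : ∀ x, χ x ≤ 1) (hε : 0 ≤ ε)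
    (hg : ∀ x, |g x| ≤ ε + χ x) (hM : h1Norm f ≤ M) :
    ∫ x, g x * massCurrent j f x ≤ ε * M ^ 2 + M * √(weightedMass χ f) := by
  have hM0 : 0 ≤ M := (h1Norm_nonneg f).trans hM
  have hj := hf.memLp_weakPartial j
  have hχf : MemLp (fun x => (χ x : ℂ) * f x) 2 volume :=
    memLp_two_ofReal_mul hf.1 hχ.smooth.continuous hχ.bound
  have i1 := (integrable_norm_mul_norm hj hf.1).const_mul ε
  have i2 := integrable_norm_mul_norm hj hχf
  have hle : ∫ x, g x * massCurrent j f x ≤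
      ∫ x, (ε * (‖weakPartial j f x‖ * ‖f x‖) + ‖weakPartial j f x‖ * ‖(χ x : ℂ) * f x‖) := by
    refine (le_abs_self _).trans ((abs_integral_le_integral_abs).trans ?_)
    refine integral_mono_of_nonneg (ae_of_all _ fun x => abs_nonneg _) (i1.add i2)
      (ae_of_all _ fun x => ?_)
    dsimp only
    rw [abs_mul, norm_mul, Complex.norm_real, Real.norm_eq_abs, abs_of_nonneg (h0 x)]
    refine (mul_le_mul (hg x) (abs_massCurrent_le j f x) (abs_nonneg _)
      (add_nonneg hε (h0 x))).trans (le_of_eq ?_)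
    ring
  rw [integral_add i1 i2, integral_const_mul] at hle
  have b1 := integral_norm_mul_norm_le hj hf.1
  have b2 := integral_norm_mul_norm_le hj hχf
  have c1 := (sqrt_integral_weakPartial_sq_le_h1Norm f j).trans hM
  have c2 := (sqrt_integral_norm_sq_le_h1Norm f).trans hM
  -- Since 0 ≤ χ ≤ 1, χ² ≤ χ.
  have c3 : √(∫ x, ‖(χ x : ℂ) * f x‖ ^ 2) ≤ √(weightedMass χ f) := by
    refine Real.sqrt_le_sqrt (integral_mono (integrable_norm_sq hχf)
      (integrable_weight_mul_norm_sq hf.1 hχ) fun x => ?_)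
    dsimp only
    rw [norm_mul, mul_pow, Complex.norm_real, Real.norm_eq_abs, sq_abs]
    exact mul_le_mul_of_nonneg_right (by nlinarith [h0 x, h1 x]) (sq_nonneg _)
  have d1 := b1.trans (mul_le_mul c1 c2 (Real.sqrt_nonneg _) hM0)
  have d2 := b2.trans (mul_le_mul c1 c3 (Real.sqrt_nonneg _) hM0)
  have d3 := mul_le_mul_of_nonneg_left d1 hε
  nlinarith

theorem massFlux_le {f : E3 → ℂ} (hf : MemH1 f) {w : E3 → ℝ} {W L M : ℝ} (hw : IsWeight w W L)
    (hM : h1Norm f ≤ M) : massFlux w f ≤ 3 * (L * M ^ 2) := by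
  have hL : 0 ≤ L := (abs_nonneg _).trans (hw.bound_deriv 0 0)
  rw [massFlux, integral_finsetSum _ fun j _ => hf.integrable_mul_massCurrent j
    (continuous_partialDeriv hw.smooth) (hw.bound_deriv j)]
  -- With the zero cutoff, `integral_mul_massCurrent_le` reduces to plain Cauchy–Schwarz.
  have h0 : IsWeight (fun _ => (0 : ℝ)) 0 0 :=
    ⟨contDiff_const, fun _ => by simp, fun j x => by simp [partialDeriv]⟩
  have h : ∀ j : Fin 3, ∫ x, partialDeriv j w x * massCurrent j f x ≤ L * M ^ 2 := fun j => by
    have := integral_mul_massCurrent_le hf j h0 (fun _ => le_rfl) (fun _ => zero_le_one) hL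
      (g := partialDeriv j w) (fun x => by simpa using hw.bound_deriv j x) hM
    simpa [weightedMass] using this
  refine (Finset.sum_le_sum fun j _ => h j).trans ?_
  simp

theorem tendsto_integral_mul_norm_sq {f : E3 → ℂ} (hf : MemLp f 2 volume) {g : ℝ → E3 → ℝ}
    (hc : ∀ ρ, Continuous (g ρ)) (h1 : ∀ᶠ ρ in atTop, ∀ x, |g ρ x| ≤ 1)
    (h0 : ∀ x, Tendsto (fun ρ => g ρ x) atTop (𝓝 0)) :
    Tendsto (fun ρ => ∫ x, g ρ x * ‖f x‖ ^ 2) atTop (𝓝 0) := by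
  have := tendsto_integral_filter_of_dominated_convergence (μ := volume) (l := (atTop : Filter ℝ))
    (F := fun ρ x => g ρ x * ‖f x‖ ^ 2) (f := fun _ => (0 : ℝ)) (fun x => ‖f x‖ ^ 2)
    (Eventually.of_forall fun ρ => (hc ρ).aestronglyMeasurable.mul
      (integrable_norm_sq hf).aestronglyMeasurable)
    (h1.mono fun ρ h => ae_of_all _ fun x => ?_) (integrable_norm_sq hf)
    (ae_of_all _ fun x => by simpa using (h0 x).mul_const (‖f x‖ ^ 2))
  · simpa using this
  · rw [norm_mul, Real.norm_eq_abs, Real.norm_eq_abs, abs_of_nonneg (sq_nonneg ‖f x‖)]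
    exact mul_le_of_le_one_left (sq_nonneg _) (h x)

/-! ### The truncated exterior weight -/

section Weight

variable {a F : ℝ → ℝ} {α : ℝ}

/-- The profile `F(s / t^α)² (1 - F(s / ρ))`, a cutoff to `t^α ≲ s ≲ ρ`. -/
def shellProfile (F : ℝ → ℝ) (α ρ t s : ℝ) : ℝ := F (s / t ^ α) ^ 2 * (1 - F (s / ρ))

/-- The weight whose gradient is `F(⟨x⟩ / t^α)² (1 - F(⟨x⟩ / ρ)) ∇⟨x⟩`. -/
def shellWeight (a F : ℝ → ℝ) (α ρ t : ℝ) (x : E3) : ℝ :=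
  ∫ s in (0 : ℝ)..japaneseBracket a x, shellProfile F α ρ t s

theorem contDiff_shellProfile (hF : IsSmoothCutoff F) (α ρ t : ℝ) :
    ContDiff ℝ ∞ (shellProfile F α ρ t) :=
  ((hF.contDiff_div _).pow 2).mul (contDiff_const.sub (hF.contDiff_div ρ))

theorem shellProfile_nonneg (hF : IsSmoothCutoff F) (α ρ t s : ℝ) : 0 ≤ shellProfile F α ρ t s :=
  mul_nonneg (sq_nonneg _) (sub_nonneg.2 (hF.le_one _))

theorem shellProfile_le_one (hF : IsSmoothCutoff F) (α ρ t s : ℝ) : shellProfile F α ρ t s ≤ 1 :=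
  mul_le_one₀ (pow_le_one₀ (hF.nonneg _) (hF.le_one _)) (sub_nonneg.2 (hF.le_one _))
    (by linarith [hF.nonneg (s / ρ)])

theorem shellProfile_of_le (hF : IsSmoothCutoff F) {ρ s : ℝ} (hρ : 0 < ρ) (hs : ρ ≤ s) (α t : ℝ) :
    shellProfile F α ρ t s = 0 := by
  rw [shellProfile, hF.eq_one _ ((one_le_div hρ).2 hs), sub_self, mul_zero]

/-- The inner edge t^α moves outward. Hence the change of the weight in time has a favourable sign
and can be discarded. -/
theorem shellProfile_antitone (hF : IsSmoothCutoff F) (hα : 0 ≤ α) (ρ : ℝ) {s t t' : ℝ}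
    (hs : 0 ≤ s) (ht : 0 < t) (htt' : t ≤ t') :
    shellProfile F α ρ t' s ≤ shellProfile F α ρ t s := by
  refine mul_le_mul_of_nonneg_right (pow_le_pow_left₀ (hF.nonneg _) (hF.mono ?_) 2)
    (sub_nonneg.2 (hF.le_one _))
  exact div_le_div_of_nonneg_left hs (Real.rpow_pos_of_pos ht α)
    (Real.rpow_le_rpow ht.le htt' hα)

theorem integral_shellProfile_le (hF : IsSmoothCutoff F) (α ρ t : ℝ) {b c : ℝ} (hbc : b ≤ c) :
    ∫ s in b..c, shellProfile F α ρ t s ≤ c - b := by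
  have := intervalIntegral.integral_mono_on (μ := volume) hbc
    ((contDiff_shellProfile hF α ρ t).continuous.intervalIntegrable b c)
    (intervalIntegrable_const (c := (1 : ℝ))) fun s _ => shellProfile_le_one hF α ρ t s
  simpa using this

theorem integral_shellProfile_nonneg (hF : IsSmoothCutoff F) (α ρ t : ℝ) {r : ℝ} (hr : 0 ≤ r) :
    0 ≤ ∫ s in (0 : ℝ)..r, shellProfile F α ρ t s :=
  intervalIntegral.integral_nonneg hr fun s _ => shellProfile_nonneg hF α ρ t s

theorem integral_shellProfile_le_radius (hF : IsSmoothCutoff F) (α t : ℝ) {ρ r : ℝ} (hρ : 0 < ρ)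
    (hr : 0 ≤ r) : ∫ s in (0 : ℝ)..r, shellProfile F α ρ t s ≤ ρ := by
  rcases le_total r ρ with h | h
  · exact (integral_shellProfile_le hF α ρ t hr).trans (by linarith)
  · have hi : ∀ b c, IntervalIntegrable (shellProfile F α ρ t) volume b c :=
      fun b c => (contDiff_shellProfile hF α ρ t).continuous.intervalIntegrable b c
    have h0 : ∫ s in ρ..r, shellProfile F α ρ t s = ∫ s in ρ..r, (0 : ℝ) :=
      intervalIntegral.integral_congr fun s hs => by
        rw [uIcc_of_le h] at hs
        exact shellProfile_of_le hF hρ hs.1 α t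
    rw [← intervalIntegral.integral_add_adjacent_intervals (hi 0 ρ) (hi ρ r), h0]
    have := integral_shellProfile_le hF α ρ t hρ.le
    simp only [intervalIntegral.integral_zero]
    linarith

theorem isWeight_shellWeight (ha : IsBump a) (hF : IsSmoothCutoff F) {ρ : ℝ} (hρ : 0 < ρ)
    (α t : ℝ) : IsWeight (shellWeight a F α ρ t) ρ 1 := by
  refine ha.isWeight_comp_japaneseBracket
    (G := fun r => ∫ s in (0 : ℝ)..r, shellProfile F α ρ t s)
    (contDiff_integral_of_contDiff (contDiff_shellProfile hF α ρ t) 0) (fun r hr => ?_)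
    fun r hr => ?_
  · rw [abs_of_nonneg (integral_shellProfile_nonneg hF α ρ t hr)]
    exact integral_shellProfile_le_radius hF α t hρ hr
  · rw [(contDiff_shellProfile hF α ρ t).continuous.deriv_integral,
      abs_of_nonneg (shellProfile_nonneg hF α ρ t r)]
    exact shellProfile_le_one hF α ρ t r

theorem partialDeriv_shellWeight (ha : IsBump a) (hF : IsSmoothCutoff F) (α ρ t : ℝ) (j : Fin 3)
    (x : E3) : partialDeriv j (shellWeight a F α ρ t) x =
      shellProfile F α ρ t (japaneseBracket a x) * partialDeriv j (japaneseBracket a) x := by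
  have := ha.partialDeriv_comp_japaneseBracket
    (contDiff_integral_of_contDiff (contDiff_shellProfile hF α ρ t) 0) j x
  rwa [(contDiff_shellProfile hF α ρ t).continuous.deriv_integral] at this

theorem shellWeight_nonneg (ha : IsBump a) (hF : IsSmoothCutoff F) (α ρ t : ℝ) (x : E3) :
    0 ≤ shellWeight a F α ρ t x :=
  integral_shellProfile_nonneg hF α ρ t (ha.japaneseBracket_nonneg x)

theorem shellWeight_le (ha : IsBump a) (hF : IsSmoothCutoff F) {ρ : ℝ} (hρ : 0 < ρ) (α t : ℝ)
    (x : E3) : shellWeight a F α ρ t x ≤ ρ * min (japaneseBracket a x / ρ) 1 := by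
  rw [mul_min_of_nonneg _ _ hρ.le, mul_div_cancel₀ _ hρ.ne', mul_one]
  have hx := ha.japaneseBracket_nonneg x
  refine le_min ?_ (integral_shellProfile_le_radius hF α t hρ hx)
  exact (integral_shellProfile_le hF α ρ t hx).trans (sub_zero _).le

theorem shellWeight_antitone (ha : IsBump a) (hF : IsSmoothCutoff F) (hα : 0 ≤ α) (ρ : ℝ)
    {t t' : ℝ} (ht : 0 < t) (htt' : t ≤ t') (x : E3) :
    shellWeight a F α ρ t' x ≤ shellWeight a F α ρ t x :=
  intervalIntegral.integral_mono_on (ha.japaneseBracket_nonneg x)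
    ((contDiff_shellProfile hF α ρ t').continuous.intervalIntegrable _ _)
    ((contDiff_shellProfile hF α ρ t).continuous.intervalIntegrable _ _)
    fun _ hs => shellProfile_antitone hF hα ρ hs.1 ht htt'

/-- Uniform continuity on the compact set [t₀, t₁] × [0, ρ] suffices, as the profile vanishes beyond
ρ. This permits freezing the weight on short time intervals. -/
theorem exists_shellProfile_sub_le (hF : IsSmoothCutoff F) (α : ℝ) {ρ t₀ t₁ ε : ℝ} (hρ : 0 < ρ)
    (ht₀ : 0 < t₀) (hε : 0 < ε) :
    ∃ δ > 0, ∀ s ∈ Icc t₀ t₁, ∀ v ∈ Icc t₀ t₁, |s - v| < δ → ∀ r, 0 ≤ r →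
      |shellProfile F α ρ s r - shellProfile F α ρ v r| ≤ ε := by
  have hcont : ContinuousOn (fun p : ℝ × ℝ => shellProfile F α ρ p.1 p.2)
      (Icc t₀ t₁ ×ˢ Icc 0 ρ) := by
    have hFc := hF.smooth.continuous
    have hpow : ContinuousOn (fun p : ℝ × ℝ => p.2 / p.1 ^ α) (Icc t₀ t₁ ×ˢ Icc 0 ρ) := by
      refine continuousOn_snd.div (continuousOn_fst.rpow_const fun p hp => ?_) fun p hp => ?_
      · exact Or.inl (ht₀.trans_le hp.1.1).ne'
      · exact (Real.rpow_pos_of_pos (ht₀.trans_le hp.1.1) α).ne'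
    exact ((hFc.comp_continuousOn hpow).pow 2).mul
      (continuousOn_const.sub (hFc.comp_continuousOn (continuousOn_snd.div_const ρ)))
  have hu := (isCompact_Icc.prod isCompact_Icc).uniformContinuousOn_of_continuous hcont
  obtain ⟨δ, hδ, h⟩ := Metric.uniformContinuousOn_iff.1 hu ε hε
  refine ⟨δ, hδ, fun s hs v hv hsv r hr => ?_⟩
  rcases le_total r ρ with hr' | hr'
  · refine le_of_lt (h (s, r) ⟨hs, hr, hr'⟩ (v, r) ⟨hv, hr, hr'⟩ ?_)
    rw [Prod.dist_eq]
    simpa [Real.dist_eq, hδ] using hsv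
  · rw [shellProfile_of_le hF hρ hr', shellProfile_of_le hF hρ hr', sub_self, abs_zero]
    exact hε.le

/-- The flux through the truncated weight is, up to small terms, the expectation of `γ`. -/
theorem massFlux_shellWeight_le (ha : IsBump a) (hF : IsSmoothCutoff F) {φ : ℝ → E3 → ℂ}
    {ρ s v ε M : ℝ} (hρ : 0 < ρ) (hv : 0 < v) (hφ : MemH1 (φ v)) (hM : h1Norm (φ v) ≤ M)
    (hε : 0 ≤ ε)
    (hsv : ∀ r, 0 ≤ r → |shellProfile F α ρ s r - shellProfile F α ρ v r| ≤ ε) :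
    massFlux (shellWeight a F α ρ s) (φ v) ≤ (exteriorGammaExpectation a F α φ v).re +
      3 * (ε * M ^ 2 + M * √(weightedMass (fun x => F (japaneseBracket a x / ρ)) (φ v))) := by
  obtain ⟨L, -, hL⟩ := hF.exists_isWeight ha
  have hχ := hL ρ hρ
  have hvα := hL (v ^ α) (Real.rpow_pos_of_pos hv α)
  have hw := isWeight_shellWeight ha hF hρ α s
  have i1 := fun j : Fin 3 => hφ.integrable_mul_massCurrent j
    (continuous_partialDeriv (j := j) hw.smooth) (hw.bound_deriv j)
  have i2 := fun j : Fin 3 => hφ.integrable_mul_massCurrent j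
    (g := fun x => F (japaneseBracket a x / v ^ α) ^ 2 * partialDeriv j (japaneseBracket a) x)
    ((hvα.smooth.continuous.pow 2).mul (continuous_partialDeriv ha.contDiff_japaneseBracket))
    (C := 1) fun x => by
      rw [abs_mul, abs_of_nonneg (sq_nonneg _)]
      exact mul_le_one₀ (pow_le_one₀ (hF.nonneg _) (hF.le_one _)) (abs_nonneg _)
        (ha.abs_partialDeriv_japaneseBracket_le j x)
  rw [re_exteriorGammaExpectation ha hF hv hφ, massFlux, integral_finsetSum _ fun j _ => i1 j,
    integral_finsetSum _ fun j _ => i2 j, ← sub_le_iff_le_add', ← Finset.sum_sub_distrib]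
  have h : ∀ j : Fin 3, (∫ x, partialDeriv j (shellWeight a F α ρ s) x * massCurrent j (φ v) x) -
      (∫ x, F (japaneseBracket a x / v ^ α) ^ 2 * partialDeriv j (japaneseBracket a) x *
        massCurrent j (φ v) x) ≤ ε * M ^ 2 +
        M * √(weightedMass (fun x => F (japaneseBracket a x / ρ)) (φ v)) := fun j => by
    rw [← integral_sub (i1 j) (i2 j)]
    simp only [← sub_mul]
    refine integral_mul_massCurrent_le hφ j hχ (fun x => hF.nonneg _) (fun x => hF.le_one _) hε
      (fun x => ?_) hM
    rw [partialDeriv_shellWeight ha hF, ← sub_mul, abs_mul]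
    have h1 := hsv _ (ha.japaneseBracket_nonneg x)
    -- The outer truncation removes F(⟨x⟩/v^α)² F(⟨x⟩/ρ), which lives only where ⟨x⟩ ≥ ρ/2.
    have h2 : |shellProfile F α ρ v (japaneseBracket a x) -
        F (japaneseBracket a x / v ^ α) ^ 2| ≤ F (japaneseBracket a x / ρ) := by
      have : shellProfile F α ρ v (japaneseBracket a x) - F (japaneseBracket a x / v ^ α) ^ 2 =
          -(F (japaneseBracket a x / v ^ α) ^ 2 * F (japaneseBracket a x / ρ)) := by
        rw [shellProfile]
        ring
      rw [this, abs_neg, abs_of_nonneg (mul_nonneg (sq_nonneg _) (hF.nonneg _))]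
      exact mul_le_of_le_one_left (hF.nonneg _) (pow_le_one₀ (hF.nonneg _) (hF.le_one _))
    have h3 := (abs_sub_le _ _ _).trans (add_le_add h1 h2)
    exact (mul_le_of_le_one_right (abs_nonneg _)
      (ha.abs_partialDeriv_japaneseBracket_le j x)).trans h3
  refine (Finset.sum_le_sum fun j _ => h j).trans ?_
  simp [mul_add]

end Weight

/-! ### Propagation -/

section Propagation

variable {N : ℝ → ℝ → ℝ → ℝ} {φ₀ : E3 → ℂ} {φ : ℝ → E3 → ℂ} {a F : ℝ → ℝ} {α M : ℝ}

theorem weightedMass_nonneg {w : E3 → ℝ} (hw : ∀ x, 0 ≤ w x) (f : E3 → ℂ) :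
    0 ≤ weightedMass w f :=
  integral_nonneg fun x => mul_nonneg (hw x) (sq_nonneg _)

/-- The flux through radius AT is O(1/(AT)), so over a time T at most O(1/A) of mass enters the
exterior. The mass initially there tends to 0 as T → ∞. -/
theorem IsGlobalSolution.exists_exterior_mass_le (hφ : IsGlobalSolution N φ₀ φ)
    (hM : ∀ t, 0 ≤ t → h1Norm (φ t) ≤ M) (ha : IsBump a) (hF : IsSmoothCutoff F) {κ : ℝ}
    (hκ : 0 < κ) : ∃ A > 0, ∀ᶠ T in atTop, ∀ t ∈ Icc 0 T,
      weightedMass (fun x => F (japaneseBracket a x / (A * T))) (φ t) ≤ κ := by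
  obtain ⟨L, hL0, hL⟩ := hF.exists_isWeight ha
  -- Chosen so that the gain 6LM²/A is at most κ/2; the other half of κ covers the initial exterior
  -- mass.
  set A : ℝ := (12 * L * M ^ 2 + 1) / κ with hA
  have hA0 : 0 < A := by positivity
  refine ⟨A, hA0, ?_⟩
  have hlim : Tendsto (fun ρ => weightedMass (fun x => F (japaneseBracket a x / ρ)) (φ 0))
      atTop (𝓝 0) := by
    refine tendsto_integral_mul_norm_sq (hφ.memH1 0 le_rfl).1
      (fun ρ => hF.smooth.continuous.comp (ha.contDiff_japaneseBracket.continuous.div_const ρ))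
      (Eventually.of_forall fun ρ x => hF.abs_le_one _) fun x => ?_
    have : Tendsto (fun ρ : ℝ => japaneseBracket a x / ρ) atTop (𝓝 0) :=
      tendsto_const_nhds.div_atTop tendsto_id
    have := (hF.smooth.continuous.tendsto 0).comp this
    rwa [hF.eq_zero 0 (by norm_num)] at this
  have hlim' := hlim.comp (tendsto_id.const_mul_atTop hA0)
  filter_upwards [(tendsto_order.1 hlim').2 (κ / 2) (by positivity), eventually_gt_atTop 0]
    with T hT hT0 t ht
  simp only [Function.comp_apply, id] at hT
  have hρ : 0 < A * T := mul_pos hA0 hT0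
  have h := hφ.weightedMass_sub_le hM (hL _ hρ) (a := 0) (b := t)
    (c := 2 * (3 * (L / (A * T) * M ^ 2))) le_rfl ht.1 fun v hv =>
      mul_le_mul_of_nonneg_left (massFlux_le (hφ.memH1 v hv.1) (hL _ hρ) (hM v hv.1)) zero_le_two
  have h2 : 2 * (3 * (L / (A * T) * M ^ 2)) * (t - 0) ≤ κ / 2 := by
    have e : 2 * (3 * (L / (A * T) * M ^ 2)) * (t - 0) = 6 * L * M ^ 2 / A * (t / T) := by
      field_simp
      ring
    have h3 : 6 * L * M ^ 2 / A ≤ κ / 2 := by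
      rw [div_le_iff₀ hA0, hA]
      have : κ / 2 * ((12 * L * M ^ 2 + 1) / κ) = 6 * L * M ^ 2 + 1 / 2 := by
        field_simp
        ring
      linarith
    rw [e]
    exact (mul_le_of_le_one_right (by positivity)
      (div_le_one_of_le₀ ht.2 hT0.le)).trans h3
  linarith

/-- If the expectation of `γ` stays below a negative constant, so does the growth rate of the
truncated exterior weight. -/
theorem IsGlobalSolution.weightedMass_shellWeight_le (hφ : IsGlobalSolution N φ₀ φ)
    (hM : ∀ t, 0 ≤ t → h1Norm (φ t) ≤ M) (ha : IsBump a) (hF : IsSmoothCutoff F) (hα : 0 ≤ α)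
    {ρ t₀ t₁ c κ : ℝ} (hρ : 0 < ρ) (ht₀ : 0 < t₀) (ht : t₀ ≤ t₁)
    (hE : ∀ v ∈ Icc t₀ t₁, (exteriorGammaExpectation a F α φ v).re ≤ c)
    (hκ : ∀ v ∈ Icc t₀ t₁, weightedMass (fun x => F (japaneseBracket a x / ρ)) (φ v) ≤ κ) :
    weightedMass (shellWeight a F α ρ t₁) (φ t₁) ≤
      weightedMass (shellWeight a F α ρ t₀) (φ t₀) + 2 * (c + 3 * (M * √κ)) * (t₁ - t₀) := by
  have hM0 : 0 ≤ M := (h1Norm_nonneg _).trans (hM 0 le_rfl)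
  have hmain : ∀ ε > 0, weightedMass (shellWeight a F α ρ t₁) (φ t₁) ≤
      weightedMass (shellWeight a F α ρ t₀) (φ t₀) +
        2 * (c + 3 * (ε * M ^ 2 + M * √κ)) * (t₁ - t₀) := by
    intro ε hε
    obtain ⟨δ, hδ, hclose⟩ := exists_shellProfile_sub_le hF α (t₁ := t₁) hρ ht₀ hε
    set d := 2 * (c + 3 * (ε * M ^ 2 + M * √κ))
    have := le_of_locally_antitone
      (G := fun t => weightedMass (shellWeight a F α ρ t) (φ t) - d * t) ht
      fun u hu => ⟨δ / 2, by positivity, fun s hs t ht hsu htu hst => ?_⟩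
    · linarith
    have hs0 : 0 < s := ht₀.trans_le hs.1
    have ht0 : 0 < t := ht₀.trans_le ht.1
    -- The weight is moved back to time s at no cost, then held fixed while the solution evolves
    -- from s to t.
    have h1 : weightedMass (shellWeight a F α ρ t) (φ t) ≤
        weightedMass (shellWeight a F α ρ s) (φ t) :=
      integral_mono
        (integrable_weight_mul_norm_sq (hφ.memH1 t ht0.le).1 (isWeight_shellWeight ha hF hρ α t))
        (integrable_weight_mul_norm_sq (hφ.memH1 t ht0.le).1 (isWeight_shellWeight ha hF hρ α s))
        fun x => mul_le_mul_of_nonneg_right (shellWeight_antitone ha hF hα ρ hs0 hst x)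
          (sq_nonneg _)
    have h2 := hφ.weightedMass_sub_le hM (isWeight_shellWeight ha hF hρ α s) (c := d) hs0.le hst
      fun v hv => by
        have hvI : v ∈ Icc t₀ t₁ := ⟨hs.1.trans hv.1, hv.2.trans ht.2⟩
        have hv0 : 0 < v := ht₀.trans_le hvI.1
        have hsv : |s - v| < δ := by
          rw [abs_lt] at *
          constructor <;> linarith [hv.1, hv.2]
        have h3 := massFlux_shellWeight_le (α := α) ha hF hρ hv0 (hφ.memH1 v hv0.le)
          (hM v hv0.le) hε.le (hclose s hs v hvI hsv)
        have h4 := mul_le_mul_of_nonneg_left (Real.sqrt_le_sqrt (hκ v hvI)) hM0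
        have h5 := hE v hvI
        linarith
    linarith
  refine le_of_forall_pos_le_add fun ε hε => ?_
  have ht' : 0 ≤ t₁ - t₀ := sub_nonneg.2 ht
  refine (hmain (ε / (6 * M ^ 2 * (t₁ - t₀) + 1)) (by positivity)).trans ?_
  have : ε / (6 * M ^ 2 * (t₁ - t₀) + 1) * (6 * M ^ 2 * (t₁ - t₀)) ≤ ε := by
    rw [div_mul_eq_mul_div, div_le_iff₀ (by positivity)]
    nlinarith
  linarith

theorem tendsto_integral_min_japaneseBracket (ha : IsBump a) {f : E3 → ℂ} (hf : MemLp f 2 volume) :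
    Tendsto (fun ρ => ∫ x, min (japaneseBracket a x / ρ) 1 * ‖f x‖ ^ 2) atTop (𝓝 0) := by
  refine tendsto_integral_mul_norm_sq hf
    (fun ρ => (ha.contDiff_japaneseBracket.continuous.div_const ρ).min continuous_const)
    ((eventually_gt_atTop 0).mono fun ρ hρ x => ?_) fun x => ?_
  · rw [abs_of_nonneg (le_min (div_nonneg (ha.japaneseBracket_nonneg x) (le_of_lt hρ))
      zero_le_one)]
    exact min_le_right _ _
  · have h : Tendsto (fun ρ : ℝ => japaneseBracket a x / ρ) atTop (𝓝 0) :=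
      tendsto_const_nhds.div_atTop tendsto_id
    simpa using h.min (tendsto_const_nhds (x := (1 : ℝ)))

/-- The integral on the right tends to 0 as ρ → ∞ for every f in L², so the weighted mass is o(ρ).
-/
theorem weightedMass_shellWeight_le_mul (ha : IsBump a) (hF : IsSmoothCutoff F) {ρ : ℝ}
    (hρ : 0 < ρ) (α t : ℝ) {f : E3 → ℂ} (hf : MemLp f 2 volume) :
    weightedMass (shellWeight a F α ρ t) f ≤
      ρ * ∫ x, min (japaneseBracket a x / ρ) 1 * ‖f x‖ ^ 2 := by
  rw [← integral_const_mul]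
  have hc : Continuous fun x => min (japaneseBracket a x / ρ) 1 :=
    (ha.contDiff_japaneseBracket.continuous.div_const ρ).min continuous_const
  have hi : Integrable fun x => min (japaneseBracket a x / ρ) 1 * ‖f x‖ ^ 2 :=
    (integrable_norm_sq hf).bdd_mul (c := 1) hc.aestronglyMeasurable (ae_of_all _ fun x => by
      rw [Real.norm_eq_abs, abs_of_nonneg (le_min (div_nonneg (ha.japaneseBracket_nonneg x)
        hρ.le) zero_le_one)]
      exact min_le_right _ _)
  refine integral_mono (integrable_weight_mul_norm_sq hf (isWeight_shellWeight ha hF hρ α t))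
    (hi.const_mul ρ) fun x => ?_
  dsimp only
  rw [← mul_assoc]
  exact mul_le_mul_of_nonneg_right (shellWeight_le ha hF hρ α t x) (sq_nonneg _)

/-- Every `γ`-limit of a bounded solution is non-negative. -/
theorem IsGammaLimit.nonneg (hφ : IsGlobalSolution N φ₀ φ) (hbound : HasUniformH1Bound φ)
    (ha : IsBump a) (hF : IsSmoothCutoff F) (hα : 0 ≤ α) {Γ : ℝ}
    (hΓ : IsGammaLimit a F α φ Γ) : 0 ≤ Γ := by
  by_contra! hneg
  obtain ⟨M, hM⟩ := hbound
  have hM0 : 0 ≤ M := (h1Norm_nonneg _).trans (hM 0 le_rfl)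
  have hre : Tendsto (fun t => (exteriorGammaExpectation a F α φ t).re) atTop (𝓝 Γ) :=
    (Complex.continuous_re.tendsto _).comp hΓ
  obtain ⟨T₁, hT₁⟩ := eventually_atTop.1 ((tendsto_order.1 hre).2 (Γ / 2) (by linarith))
  set t₀ := max T₁ 1
  have ht₀ : 0 < t₀ := zero_lt_one.trans_le (le_max_right _ _)
  have hq : 0 < -Γ / (12 * (M + 1)) := div_pos (by linarith) (by positivity)
  -- Taking κ = q² makes the truncation error 6Mq at most |Γ|/2, half of the decay rate |Γ| provided
  -- by the bound Γ/2 on the expectation.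
  set q := -Γ / (12 * (M + 1)) with hqdef
  obtain ⟨A, hA, hext⟩ := hφ.exists_exterior_mass_le hM ha hF (pow_pos hq 2)
  have hφt₀ := hφ.memH1 t₀ ht₀.le
  have hmin := (tendsto_integral_min_japaneseBracket ha hφt₀.1).comp
    (tendsto_id.const_mul_atTop hA)
  -- After multiplication by ρ = AT the starting weighted mass is below |Γ|T/8.
  have hsmall := (tendsto_order.1 hmin).2 (-Γ / (8 * A)) (div_pos (by linarith) (by positivity))
  obtain ⟨T, hText, hTsmall, hT⟩ :=
    (hext.and (hsmall.and (eventually_ge_atTop (2 * t₀)))).exists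
  simp only [Function.comp_apply, id] at hTsmall
  have hT0 : 0 < T := by linarith
  have hρ : 0 < A * T := mul_pos hA hT0
  have h1 := hφ.weightedMass_shellWeight_le hM ha hF hα hρ ht₀ (by linarith : t₀ ≤ T)
    (fun v hv => (hT₁ v ((le_max_left _ _).trans hv.1)).le)
    (fun v hv => hText v ⟨ht₀.le.trans hv.1, hv.2⟩)
  rw [Real.sqrt_sq hq.le] at h1
  have h2 := weightedMass_shellWeight_le_mul ha hF hρ α t₀ hφt₀.1
  have h3 := weightedMass_nonneg (shellWeight_nonneg ha hF α (A * T) T) (φ T)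
  have h4 : M * q ≤ -Γ / 12 := by
    rw [hqdef, ← mul_div_assoc, div_le_div_iff₀ (by positivity) (by norm_num)]
    nlinarith
  have h5 : 2 * (Γ / 2 + 3 * (M * q)) * (T - t₀) ≤ Γ / 2 * (T - t₀) :=
    mul_le_mul_of_nonneg_right (by linarith) (by linarith)
  have h6 : Γ / 2 * (T - t₀) ≤ Γ / 4 * T := by nlinarith
  have h7 := mul_lt_mul_of_pos_left hTsmall hρ
  have h8 : A * T * (-Γ / (8 * A)) = -Γ / 8 * T := by
    field_simp
  -- As T ≥ 2t₀, the decrease is at least |Γ|T/4, so the final weighted mass would be below −|Γ|T/8.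
  nlinarith

end Propagation

end RadialNLS

end

theorem mainTheorem5
    (a : ℝ → ℝ) (ha : RadialNLS.IsBump a)
    (N : ℝ → ℝ → ℝ → ℝ)
    (φ₀ : RadialNLS.E3 → ℂ) (hφ₀ : RadialNLS.MemH1 φ₀) (hφ₀_rad : RadialNLS.IsRadial φ₀)
    (hφ₀_weight : Integrable (fun x => ‖x‖ ^ (1 / 2 : ℝ) * ‖φ₀ x‖ ^ 2))
    (φ : ℝ → RadialNLS.E3 → ℂ) (hφ : RadialNLS.IsGlobalSolution N φ₀ φ)
    (hbound : RadialNLS.HasUniformH1Bound φ)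
    (α : ℝ) (hα : α ∈ Ioo (1 / 3 : ℝ) 1)
    (F : ℝ → ℝ) (hF : RadialNLS.IsSmoothCutoff F)
    (Γ : ℝ) (hΓ : RadialNLS.IsGammaLimit a F α φ Γ) :
    0 ≤ Γ :=
  RadialNLS.IsGammaLimit.nonneg hφ hbound ha hF ((by norm_num : (0 : ℝ) ≤ 1 / 3).trans hα.1.le) hΓ
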